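/- Let $\ell\ge 0$, let $1\le\lambda_1\le\cdots\le\lambda_\ell$ be integers, $N=\sum_i\lambda_i$ and $k_i=\lambda_i+i-1$ for $i=1,\dots,\ell$. Let $h(n,x)=H_n(x)$ be the classical Hermite polynomials, $H_0=1$, $H_{n+1}=2xH_n-H_n'$, and let $\operatorname{Wr}$ denote the Wronskian determinant with respect to $x$ (the empty Wronskian is $1$). Put $\eta=\operatorname{Wr}[h(k_1,x),\dots,h(k_\ell,x)]$, let $\tilde h_j$ be the Wronskian of the same functions with $h(k_j,x)$ omitted, and define the differential operators $$A(y)=\operatorname{Wr}[h(k_1,x),\dots,h(k_\ell,x),y],\qquad B(y)=(-1)^{\lfloor \ell/2\rfloor}e^{x^2}\eta^{-\ell}\operatorname{Wr}[\tilde h_1,\dots,\tilde h_\ell,e^{-x^2}y],$$ $$T(y)=y''-2xy',\qquad \hat T(y)=y''-2\Bigl(x+\frac{\eta'}{\eta}\Bigr)y'+\Bigl(\frac{\eta''}{\eta}+2x\frac{\eta'}{\eta}\Bigr)y .$$ Let $\hat h(n,x)=A(h(n+\ell-N,x))$ for integers $n\ge N-\ell$, $n\ge 0$, and let $\pi(n)=\prod_{i=1}^{\ell}(-2n+2k_i)$.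 Here the variable $x$ and the functions are either all real or all complex (derivatives being taken in that field). Then $\eta$ has only finitely many zeros, so that the operators are defined outside a finite set. As differential operators there (that is, when applied at any point $x$ with $\eta(x)\neq0$ to any function that is $2\ell$ times continuously differentiable near $x$), $$B\circ A=(T+2k_1)\circ\cdots\circ(T+2k_\ell),\qquad A\circ B=(\hat T-2\ell+2k_1)\circ\cdots\circ(\hat T-2\ell+2k_\ell).$$ Moreover, at every $x$ with $\eta(x)\ne0$, $$(B\circ A)h(n,x)=\pi(n)\,h(n,x)\quad(n\ge 0),\qquad (A\circ B)\hat h(n,x)=\pi(n-N+\ell)\,\hat h(n,x)\quad(n\ge N-\ell,\ n\ge 0).$$ -/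

import Mathlib

namespace ExceptionalHermite

noncomputable section

open Polynomial

/-- The classical (physicists') Hermite polynomials `H_n`, with `H_n(x) = 2 ^ n x ^ n + ⋯`; the
recursion is the one satisfied by `(-1) ^ n * exp (x ^ 2) * (d/dx) ^ n exp (-x ^ 2)`. -/
def physHermite : ℕ → ℤ[X]
  | 0 => 1
  | n + 1 => 2 * X * physHermite n - derivative (physHermite n)

/-- `h(n, x) = H_n(x)` as a function of `x`. -/
def h (𝕜 : Type*) [RCLike 𝕜] (n : ℕ) : 𝕜 → 𝕜 := fun x => aeval x (physHermite n)

/-- The Wronskian determinant of `f 0, …, f (m - 1)`; the empty Wronskian is `1`. -/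
def Wr {𝕜 : Type*} [RCLike 𝕜] {m : ℕ} (f : Fin m → 𝕜 → 𝕜) : 𝕜 → 𝕜 := fun x =>
  Matrix.det (Matrix.of fun i j : Fin m => iteratedDeriv (i : ℕ) (f j) x)

/-- `WrOmit f j` is the Wronskian of the family `f` with its `j`-th member omitted. -/
def WrOmit {𝕜 : Type*} [RCLike 𝕜] : {m : ℕ} → (Fin m → 𝕜 → 𝕜) → Fin m → 𝕜 → 𝕜
  | 0, _, j => j.elim0
  | _ + 1, f, j => Wr fun i => f (j.succAbove i)

/-- `k_i = λ_i + i - 1` for `i = 1, …, ℓ`; here the index `i` starts from `0`. -/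
def kSeq {ℓ : ℕ} (lam : Fin ℓ → ℕ) (i : Fin ℓ) : ℕ := lam i + i

/-- `N = ∑ λ_i`. -/
def size {ℓ : ℕ} (lam : Fin ℓ → ℕ) : ℕ := ∑ i, lam i

/-- The functions `h(k_1, x), …, h(k_ℓ, x)`. -/
def hK (𝕜 : Type*) [RCLike 𝕜] {ℓ : ℕ} (lam : Fin ℓ → ℕ) (i : Fin ℓ) : 𝕜 → 𝕜 :=
  h 𝕜 (kSeq lam i)

/-- `η = Wr(h(k_1, x), …, h(k_ℓ, x))`. -/
def η (𝕜 : Type*) [RCLike 𝕜] {ℓ : ℕ} (lam : Fin ℓ → ℕ) : 𝕜 → 𝕜 := Wr (hK 𝕜 lam)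

/-- The operator `A(y) = Wr(h(k_1, x), …, h(k_ℓ, x), y)`. -/
def opA {𝕜 : Type*} [RCLike 𝕜] {ℓ : ℕ} (lam : Fin ℓ → ℕ) (y : 𝕜 → 𝕜) : 𝕜 → 𝕜 :=
  Wr (Fin.snoc (α := fun _ : Fin (ℓ + 1) => 𝕜 → 𝕜) (hK 𝕜 lam) y)

/-- The operator
`B(y) = (-1) ^ ⌊ℓ / 2⌋ * exp (x ^ 2) * η ^ (-ℓ) * Wr(h̃_1, …, h̃_ℓ, exp (-x ^ 2) * y)`, where `h̃_j`
is the Wronskian of the functions `h(k_i, x)`, `i ≠ j`. -/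
def opB {𝕜 : Type*} [RCLike 𝕜] {ℓ : ℕ} (lam : Fin ℓ → ℕ) (y : 𝕜 → 𝕜) : 𝕜 → 𝕜 := fun x =>
  (-1) ^ (ℓ / 2) * NormedSpace.exp (x ^ 2) * ((η 𝕜 lam x) ^ ℓ)⁻¹ *
    Wr (Fin.snoc (α := fun _ : Fin (ℓ + 1) => 𝕜 → 𝕜) (WrOmit (hK 𝕜 lam))
      (fun t => NormedSpace.exp (-t ^ 2) * y t)) x

/-- The Hermite operator `T(y) = y'' - 2 x y'`. -/
def opT {𝕜 : Type*} [RCLike 𝕜] (y : 𝕜 → 𝕜) : 𝕜 → 𝕜 := fun x =>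
  deriv (deriv y) x - 2 * x * deriv y x

/-- The exceptional Hermite operator
`T̂(y) = y'' - 2 (x + η' / η) y' + (η'' / η + 2 x η' / η) y`. -/
def opThat {𝕜 : Type*} [RCLike 𝕜] {ℓ : ℕ} (lam : Fin ℓ → ℕ) (y : 𝕜 → 𝕜) : 𝕜 → 𝕜 := fun x =>
  deriv (deriv y) x - 2 * (x + deriv (η 𝕜 lam) x / η 𝕜 lam x) * deriv y x
    + (deriv (deriv (η 𝕜 lam)) x / η 𝕜 lam x
        + 2 * x * (deriv (η 𝕜 lam) x / η 𝕜 lam x)) * y x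

/-- The operator `S + c`. -/
def addScalar {𝕜 : Type*} [RCLike 𝕜] (S : (𝕜 → 𝕜) → 𝕜 → 𝕜) (c : 𝕜) (y : 𝕜 → 𝕜) : 𝕜 → 𝕜 :=
  fun x => S y x + c * y x

/-- The composition `S 0 ∘ S 1 ∘ ⋯ ∘ S (m - 1)`. -/
def compose {F : Type*} {m : ℕ} (S : Fin m → F → F) : F → F :=
  (List.ofFn S).foldr (fun U V => U ∘ V) id

/-- The exceptional Hermite polynomial `ĥ(n, x) = A(h(n + ℓ - N, x))`, for `n ≥ N - ℓ`. -/
def hHat (𝕜 : Type*) [RCLike 𝕜] {ℓ : ℕ} (lam : Fin ℓ → ℕ) (n : ℕ) : 𝕜 → 𝕜 :=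
  opA lam (h 𝕜 (n + ℓ - size lam))

/-- `π(n) = ∏ (-2 n + 2 k_i)`. -/
def piFun {ℓ : ℕ} (lam : Fin ℓ → ℕ) (n : ℤ) : ℤ := ∏ i, (-2 * n + 2 * (kSeq lam i : ℤ))

end

end ExceptionalHermite

/-! ### Linear differential operators over a differential field. -/

namespace DiffOp

open Matrix

variable {K : Type*} [Field K] (D : Derivation ℤ K K)

/-! The identities come from a chain of Darboux transformations of the Hermite operator T, carried
out over an abstract differential field of characteristic zero with an element x such that x' = 1.
The seeds φ_i satisfy (T + 2 k_i) φ_i = 0 with distinct k_i. Let M = η⁻¹ A be the monic operator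
with kernel spanned by the seeds, and p = ∏ (X + 2 k_i). Adding one seed multiplies M on the left by
a first order factor D - u, where u is a logarithmic derivative. The Riccati equation for u factors
the shifted transformed operator as (D + u - 2x)(D - u). Induction (`IsDarboux.step`, `isDarboux`)
gives η ≠ 0, a monic Q with Q M = p(T), and M T = T₁ M for T₁ = T - 2ℓ + 2 (η'/η)'. Then M Q M = M
p(T) = p(T₁) M, and cancelling M on the right gives M Q = p(T₁).

It remains to identify Q. Whichever seed is added last, the last left factor kills E h̃_j / η, where
E' = 2xE. By right cancellation Q is the same for every j, so it kills all these functions. A monic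
operator is determined by a full independent set of solutions (`IsMonic.eq_wrOp`). The Wronskian of
the h̃_j (`wr_mul_wr_wrOmit`) supplies both their independence and the constant in B, whence B(y) =
Q(y/η) (`IsMonic.apply_div_wr`). Conjugation by η turns T₁ into T̂ - 2ℓ.

The algebra is applied to Taylor expansions at a point x₀ with η(x₀) ≠ 0. Intermediate Wronskians
may vanish at x₀, so it takes place in the fraction field of formal power series. `HasJet` keeps
track of how many derivatives of a function its expansion controls, and `HasJet.eval_eq` carries the
formal identities back to values at x₀. -/

/-- The Wronskian determinant in a differential field. -/
def wr {m : ℕ} (f : Fin m → K) : K := Matrix.det (Matrix.of fun i j : Fin m => D^[(i : ℕ)] (f j))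

/-- The derivation as an additive endomorphism. -/
def dOp : Module.End ℤ K := (D : K →ₗ[ℤ] K)

@[simp] lemma dOp_apply (y : K) : dOp D y = D y := rfl

lemma dOp_pow_apply (n : ℕ) (y : K) : (dOp D ^ n) y = D^[n] y := by
  rw [Module.End.pow_apply]; rfl

/-- The linear differential operators of order less than `n`. -/
def opLT (n : ℕ) : Submodule K (Module.End ℤ K) :=
  Submodule.span K (Set.range fun i : Fin n => dOp D ^ (i : ℕ))

lemma exists_coeff_of_mem_opLT {n : ℕ} {L : Module.End ℤ K} (hL : L ∈ opLT D n) :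
    ∃ c : Fin n → K, L = ∑ i, c i • dOp D ^ (i : ℕ) := by
  obtain ⟨c, hc⟩ := (Submodule.mem_span_range_iff_exists_fun K).1 hL
  exact ⟨c, hc.symm⟩

lemma dOp_pow_mem_opLT {i n : ℕ} (hi : i < n) : dOp D ^ i ∈ opLT D n :=
  Submodule.subset_span ⟨⟨i, hi⟩, rfl⟩

lemma opLT_mono {m n : ℕ} (hmn : m ≤ n) : opLT D m ≤ opLT D n := by
  refine Submodule.span_le.2 ?_
  rintro _ ⟨i, rfl⟩
  exact dOp_pow_mem_opLT D (i.2.trans_le hmn)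

lemma dOp_mul_smul (c : K) (L : Module.End ℤ K) :
    dOp D * (c • L) = D c • L + c • (dOp D * L) := by
  ext y
  simp [mul_comm, add_comm]

lemma dOp_mul_mem_opLT {n : ℕ} {L : Module.End ℤ K} (hL : L ∈ opLT D n) :
    dOp D * L ∈ opLT D (n + 1) := by
  induction hL using Submodule.span_induction with
  | mem L h =>
    obtain ⟨i, rfl⟩ := h
    rw [← pow_succ']
    exact dOp_pow_mem_opLT D (by omega)
  | zero => simp
  | add L L' _ _ h h' => rw [mul_add]; exact add_mem h h'
  | smul c L hL h =>
    rw [dOp_mul_smul]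
    exact add_mem (Submodule.smul_mem _ _ (opLT_mono D (Nat.le_succ n) hL)) (Submodule.smul_mem _ _ h)

lemma dOp_pow_mul_mem_opLT {n : ℕ} (m : ℕ) {L : Module.End ℤ K} (hL : L ∈ opLT D n) :
    dOp D ^ m * L ∈ opLT D (n + m) := by
  induction m with
  | zero => simpa using hL
  | succ m ih =>
    rw [pow_succ', mul_assoc]
    exact dOp_mul_mem_opLT D ih

/-- Orders add under composition. The bounds are strict, so only one of the two carries the extra 1.
-/
lemma mul_mem_opLT {m n : ℕ} {L M : Module.End ℤ K} (hL : L ∈ opLT D m)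
    (hM : M ∈ opLT D (n + 1)) : L * M ∈ opLT D (m + n) := by
  induction hL using Submodule.span_induction with
  | mem L h =>
    obtain ⟨i, rfl⟩ := h
    exact opLT_mono D (by omega) (dOp_pow_mul_mem_opLT D i hM)
  | zero => simp
  | add L L' _ _ h h' => rw [add_mul]; exact add_mem h h'
  | smul c L hL h => rw [smul_mul_assoc]; exact Submodule.smul_mem _ _ h

/-- Monic differential operators of order `n`. -/
def IsMonic (n : ℕ) (L : Module.End ℤ K) : Prop := L - dOp D ^ n ∈ opLT D n

variable {D}

lemma IsMonic.mem_opLT {n : ℕ} {L : Module.End ℤ K} (hL : IsMonic D n L) : L ∈ opLT D (n + 1) := by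
  have := add_mem (opLT_mono D (Nat.le_succ n) hL) (dOp_pow_mem_opLT D (Nat.lt_succ_self n))
  simpa using this

lemma IsMonic.mul {m n : ℕ} {L M : Module.End ℤ K} (hL : IsMonic D m L) (hM : IsMonic D n M) :
    IsMonic D (m + n) (L * M) := by
  have h : L * M - dOp D ^ (m + n) = (L - dOp D ^ m) * M + dOp D ^ m * (M - dOp D ^ n) := by
    rw [pow_add]; noncomm_ring
  rw [IsMonic, h]
  refine add_mem (mul_mem_opLT D hL hM.mem_opLT) ?_
  rw [add_comm m n]
  exact dOp_pow_mul_mem_opLT D m hM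

variable (D)

lemma isMonic_one : IsMonic D 0 1 := by
  simp [IsMonic]

lemma smul_one_mem_opLT (v : K) : v • (1 : Module.End ℤ K) ∈ opLT D 1 :=
  Submodule.smul_mem _ _ (by simpa using dOp_pow_mem_opLT D (i := 0) (n := 1) one_pos)

lemma isMonic_dOp_add (v : K) : IsMonic D 1 (dOp D + v • (1 : Module.End ℤ K)) := by
  simpa [IsMonic] using smul_one_mem_opLT D v

lemma isMonic_dOp_pow (n : ℕ) : IsMonic D n (dOp D ^ n) := by
  simp [IsMonic]

variable {D}

lemma iterate_mul_of_deriv_eq_one {x : K} (hx : D x = 1) (n : ℕ) (y : K) :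
    D^[n + 1] (x * y) = x * D^[n + 1] y + (n + 1) * D^[n] y := by
  induction n with
  | zero => simp [hx, add_comm]
  | succ n ih =>
    rw [Function.iterate_succ_apply', ih, Function.iterate_succ_apply' (n := n + 1)]
    simp only [map_add, Derivation.leibniz, hx, smul_eq_mul, Function.iterate_succ_apply',
      Derivation.map_natCast, Derivation.map_one_eq_zero]
    push_cast
    ring

/-- Commuting with multiplication by x lowers the order: the relation at x y minus x times the
relation at y is a shorter relation with coefficients (i + 1) c_{i+1}. These vanish by induction,
hence so do the c_{i+1} in characteristic zero, and y = 1 disposes of c_0. -/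
lemma coeff_eq_zero [CharZero K] {x : K} (hx : D x = 1) {n : ℕ} (c : Fin n → K)
    (hc : ∀ y, ∑ i, c i * D^[(i : ℕ)] y = 0) : c = 0 := by
  induction n with
  | zero => exact Subsingleton.elim _ _
  | succ n ih =>
    have hsucc : (fun i : Fin n => c i.succ * (i + 1 : K)) = 0 := by
      refine ih _ fun y => ?_
      have h1 := hc (x * y)
      have h2 := hc y
      rw [Fin.sum_univ_succ] at h1 h2
      simp only [Fin.val_succ, iterate_mul_of_deriv_eq_one hx, Fin.val_zero,
        Function.iterate_zero_apply, mul_add, Finset.sum_add_distrib] at h1 h2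
      have h3 : ∑ i : Fin n, c i.succ * (x * D^[(i : ℕ) + 1] y)
          = x * ∑ i : Fin n, c i.succ * D^[(i : ℕ) + 1] y := by
        rw [Finset.mul_sum]
        exact Finset.sum_congr rfl fun i _ => by ring
      rw [h3] at h1
      have h4 : ∑ i : Fin n, c i.succ * (i + 1 : K) * D^[(i : ℕ)] y
          = ∑ i : Fin n, c i.succ * ((i + 1 : K) * D^[(i : ℕ)] y) :=
        Finset.sum_congr rfl fun i _ => by ring
      rw [h4]
      linear_combination h1 - x * h2
    have hs : ∀ i : Fin n, c i.succ = 0 := fun i => by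
      have := congrFun hsucc i
      simpa [Nat.cast_add_one_ne_zero] using this
    have h0 : c 0 = 0 := by
      have := hc 1
      rw [Fin.sum_univ_succ] at this
      simpa [hs] using this
    funext i
    exact Fin.cases h0 hs i

lemma eq_zero_of_smul_dOp_pow_add [CharZero K] {x : K} (hx : D x = 1) {n : ℕ} {c : K}
    {L : Module.End ℤ K} (hL : L ∈ opLT D n) (h : L + c • dOp D ^ n = 0) : c = 0 := by
  obtain ⟨a, rfl⟩ := exists_coeff_of_mem_opLT D hL
  have := coeff_eq_zero hx (Fin.snoc (α := fun _ => K) a c) fun y => by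
    rw [Fin.sum_univ_castSucc]
    have := congrArg (fun F : Module.End ℤ K => F y) h
    simpa [dOp_pow_apply] using this
  simpa using congrFun this (Fin.last n)

/-- Monic differential operators can be cancelled on the right. -/
lemma IsMonic.eq_zero_of_mul_eq_zero [CharZero K] {x : K} (hx : D x = 1) {n : ℕ}
    {M : Module.End ℤ K} (hM : IsMonic D n M) {m : ℕ} {L : Module.End ℤ K} (hL : L ∈ opLT D m)
    (h : L * M = 0) : L = 0 := by
  induction m generalizing L with
  | zero =>
    obtain ⟨a, rfl⟩ := exists_coeff_of_mem_opLT D hL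
    simp
  | succ m ih =>
    obtain ⟨a, rfl⟩ := exists_coeff_of_mem_opLT D hL
    rw [Fin.sum_univ_castSucc] at h ⊢
    set L₀ : Module.End ℤ K := ∑ i : Fin m, a i.castSucc • dOp D ^ (i.castSucc : ℕ) with hL₀
    have hmem : L₀ ∈ opLT D m := by
      refine Submodule.sum_mem _ fun i _ => Submodule.smul_mem _ _ (dOp_pow_mem_opLT D i.2)
    -- Since M is monic, the coefficient of order m + n in L M is the top coefficient of L.
    have hlast : a (Fin.last m) = 0 := by
      have h1 := ((isMonic_dOp_pow D m).mul hM)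
      refine eq_zero_of_smul_dOp_pow_add hx (n := m + n)
        (L := L₀ * M + a (Fin.last m) • (dOp D ^ m * M - dOp D ^ (m + n))) ?_ ?_
      · exact add_mem (mul_mem_opLT D hmem hM.mem_opLT) (Submodule.smul_mem _ _ h1)
      · rw [← h, add_mul, smul_mul_assoc, smul_sub, Fin.val_last]
        abel
    rw [hlast, zero_smul, add_zero] at h ⊢
    exact ih hmem h

lemma IsMonic.mul_right_cancel [CharZero K] {x : K} (hx : D x = 1) {n : ℕ}
    {M : Module.End ℤ K} (hM : IsMonic D n M) {m : ℕ} {L L' : Module.End ℤ K} (hL : L ∈ opLT D m)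
    (hL' : L' ∈ opLT D m) (h : L * M = L' * M) : L = L' :=
  sub_eq_zero.1 (hM.eq_zero_of_mul_eq_zero hx (sub_mem hL hL') (by rw [sub_mul, h, sub_self]))

variable (D)

/-- The operator `y ↦ Wr(f 0, …, f (m - 1), y)`. -/
def wrOp {m : ℕ} (f : Fin m → K) : Module.End ℤ K :=
  ∑ i : Fin (m + 1), ((-1) ^ (i + m : ℕ) *
    Matrix.det (Matrix.of fun a b : Fin m => D^[(i.succAbove a : ℕ)] (f b))) • dOp D ^ (i : ℕ)

lemma wrOp_apply {m : ℕ} (f : Fin m → K) (y : K) :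
    wrOp D f y = wr D (Fin.snoc (α := fun _ => K) f y) := by
  rw [wr, Matrix.det_succ_column _ (Fin.last m)]
  simp only [wrOp, LinearMap.sum_apply, LinearMap.smul_apply, dOp_pow_apply, smul_eq_mul]
  refine Finset.sum_congr rfl fun i _ => ?_
  have : (Matrix.of fun a b : Fin (m + 1) => D^[(a : ℕ)]
      ((Fin.snoc f y : Fin (m + 1) → K) b)).submatrix i.succAbove (Fin.last m).succAbove =
      Matrix.of fun a b : Fin m => D^[(i.succAbove a : ℕ)] (f b) := by
    ext a b
    simp
  rw [this]
  simp
  ring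

/-- In the expansion along the last column, the minor of the highest derivative is the Wronskian of
f itself, with sign +1. -/
lemma wrOp_sub_mem {m : ℕ} (f : Fin m → K) : wrOp D f - wr D f • dOp D ^ m ∈ opLT D m := by
  rw [wrOp, Fin.sum_univ_castSucc]
  have : (-1 : K) ^ ((Fin.last m : ℕ) + m) * Matrix.det (Matrix.of fun a b : Fin m =>
      D^[((Fin.last m).succAbove a : ℕ)] (f b)) = wr D f := by
    simp [wr, ← two_mul]
  rw [this, Fin.val_last, add_sub_cancel_right]
  exact Submodule.sum_mem _ fun i _ => Submodule.smul_mem _ _ (dOp_pow_mem_opLT D i.2)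

lemma isMonic_wrOp {m : ℕ} {f : Fin m → K} (hf : wr D f ≠ 0) :
    IsMonic D m ((wr D f)⁻¹ • wrOp D f) := by
  have := Submodule.smul_mem _ (wr D f)⁻¹ (wrOp_sub_mem D f)
  rwa [smul_sub, smul_smul, inv_mul_cancel₀ hf, one_smul] at this

lemma wrOp_apply_self {m : ℕ} (f : Fin m → K) (j : Fin m) : wrOp D f (f j) = 0 := by
  rw [wrOp_apply, wr]
  refine Matrix.det_zero_of_column_eq (Fin.castSucc_lt_last j).ne fun a => ?_
  simp

variable {D}

/-- A monic operator is determined by a full set of independent solutions. -/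
lemma IsMonic.eq_wrOp {m : ℕ} {f : Fin m → K} (hf : wr D f ≠ 0) {L : Module.End ℤ K}
    (hL : IsMonic D m L) (hk : ∀ j, L (f j) = 0) : L = (wr D f)⁻¹ • wrOp D f := by
  have hmem : L - (wr D f)⁻¹ • wrOp D f ∈ opLT D m := by
    have := sub_mem hL (isMonic_wrOp D hf)
    simpa using this
  obtain ⟨c, hc⟩ := exists_coeff_of_mem_opLT D hmem
  have hc0 : c = 0 := by
    -- The difference has order below m and kills every f j, so its coefficient vector lies in the
    -- left kernel of the nonsingular Wronskian matrix.
    refine Matrix.eq_zero_of_vecMul_eq_zero hf (funext fun j => ?_)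
    have := congrArg (fun F : Module.End ℤ K => F (f j)) hc
    simp only [LinearMap.sub_apply, LinearMap.smul_apply, hk, wrOp_apply_self, LinearMap.sum_apply,
      dOp_pow_apply, smul_eq_mul, mul_zero, sub_zero] at this
    simp only [Matrix.vecMul, dotProduct, Matrix.of_apply, Pi.zero_apply]
    exact this.symm
  rw [← sub_eq_zero, hc]
  simp [hc0]

end DiffOp

/-! ### Darboux transformations of the Hermite operator. -/

namespace DiffOp

open Matrix

variable {K : Type*} [Field K] (D : Derivation ℤ K K)

/-- The operator `y ↦ y'' - 2 x y' + b y`. -/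
def hermOp (x b : K) : Module.End ℤ K := dOp D * dOp D - (2 * x) • dOp D + b • 1

@[simp] lemma hermOp_apply (x b y : K) : hermOp D x b y = D (D y) - 2 * x * D y + b * y := by
  simp [hermOp]

lemma hermOp_mem_opLT (x b : K) : hermOp D x b ∈ opLT D 3 := by
  refine add_mem (sub_mem ?_ (Submodule.smul_mem _ _ ?_))
    (opLT_mono D (by norm_num) (smul_one_mem_opLT D b))
  · rw [← pow_two]
    exact dOp_pow_mem_opLT D (by norm_num)
  · simpa using dOp_pow_mem_opLT D (i := 1) (n := 3) (by norm_num)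

/-- The polynomial `∏ (X + 2 k_i)`. -/
noncomputable def shiftPoly {m : ℕ} (k : Fin m → ℕ) : Polynomial ℤ :=
  ∏ i, (Polynomial.X + Polynomial.C (2 * (k i : ℤ)))

lemma aeval_hermOp_X_add_C (x b : K) (k : ℕ) :
    Polynomial.aeval (hermOp D x b) (Polynomial.X + Polynomial.C (2 * (k : ℤ))) =
      hermOp D x (b + 2 * k) := by
  ext y
  rw [map_add, Polynomial.aeval_X, Polynomial.aeval_C, LinearMap.add_apply,
    Module.algebraMap_end_apply]
  simp
  ring

/-- Right cancellation needs both sides to be differential operators of some finite order; the exact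
bound is irrelevant. -/
lemma exists_aeval_mem_opLT {T : Module.End ℤ K} (hT : T ∈ opLT D 3) (p : Polynomial ℤ) :
    ∃ n, Polynomial.aeval T p ∈ opLT D n := by
  induction p using Polynomial.induction_on with
  | C a =>
    refine ⟨1, ?_⟩
    have h : Polynomial.aeval T (Polynomial.C a) = (a : K) • (1 : Module.End ℤ K) := by
      ext y
      simp
    rw [h]
    exact smul_one_mem_opLT D _
  | add p q hp hq =>
    obtain ⟨m, hm⟩ := hp
    obtain ⟨n, hn⟩ := hq
    refine ⟨max m n, ?_⟩
    rw [map_add]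
    exact add_mem (opLT_mono D (le_max_left _ _) hm) (opLT_mono D (le_max_right _ _) hn)
  | monomial n a hp =>
    obtain ⟨m, hm⟩ := hp
    refine ⟨m + 2, ?_⟩
    rw [pow_succ, ← mul_assoc, map_mul, Polynomial.aeval_X]
    exact mul_mem_opLT D hm hT

lemma mul_aeval_of_mul_eq {M T T' : Module.End ℤ K} (h : M * T = T' * M) (p : Polynomial ℤ) :
    M * Polynomial.aeval T p = Polynomial.aeval T' p * M := by
  induction p using Polynomial.induction_on with
  | C a => rw [Polynomial.aeval_C, Polynomial.aeval_C]; exact (Algebra.commutes a M).symm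
  | add p q hp hq => rw [map_add, map_add, mul_add, add_mul, hp, hq]
  | monomial n a hp =>
    rw [pow_succ, ← mul_assoc, map_mul _ (_ * _) _, map_mul _ (_ * _) _, Polynomial.aeval_X,
      Polynomial.aeval_X, ← mul_assoc, hp, mul_assoc, h, mul_assoc]

/-- The monic operator with kernel spanned by the family `φ`. -/
def darbouxOp {m : ℕ} (φ : Fin m → K) : Module.End ℤ K := (wr D φ)⁻¹ • wrOp D φ

lemma darbouxOp_apply_self {m : ℕ} (φ : Fin m → K) (j : Fin m) : darbouxOp D φ (φ j) = 0 := by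
  simp [darbouxOp, wrOp_apply_self]

/-- The potential of the Hermite operator after the Darboux transformation with seeds `φ`. -/
def darbouxPot {m : ℕ} (φ : Fin m → K) : K := -2 * m + 2 * D (D (wr D φ) / wr D φ)

/-- The factorization and intertwining relations of a Darboux transformation with seeds `φ`. -/
structure IsDarboux (x : K) {m : ℕ} (φ : Fin m → K) (k : Fin m → ℕ) : Prop where
  wr_ne_zero : wr D φ ≠ 0
  factor : ∃ Q, IsMonic D m Q ∧
    Q * darbouxOp D φ = Polynomial.aeval (hermOp D x 0) (shiftPoly k)
  intertwine : darbouxOp D φ * hermOp D x 0 = hermOp D x (darbouxPot D φ) * darbouxOp D φ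

lemma wr_eq_wrOp_succAbove {m : ℕ} (φ : Fin (m + 1) → K) (j : Fin (m + 1)) :
    wr D φ = (-1) ^ (m + j : ℕ) * wrOp D (fun i => φ (j.succAbove i)) (φ j) := by
  rw [wr, Matrix.det_succ_column _ j]
  simp only [wrOp, LinearMap.sum_apply, LinearMap.smul_apply, dOp_pow_apply, smul_eq_mul,
    Finset.mul_sum]
  refine Finset.sum_congr rfl fun i _ => ?_
  have h1 : (Matrix.of fun a b : Fin (m + 1) => D^[(a : ℕ)] (φ b)).submatrix i.succAbove
      j.succAbove = Matrix.of fun a b : Fin m => D^[(i.succAbove a : ℕ)] (φ (j.succAbove b)) := rfl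
  have h2 : (-1 : K) ^ (m + j : ℕ) * (-1) ^ (i + m : ℕ) = (-1) ^ (i + j : ℕ) := by
    rw [← pow_add, show m + (j : ℕ) + (i + m) = i + j + 2 * m by ring, pow_add _ _ (2 * m), pow_mul]
    simp
  rw [h1, Matrix.of_apply, ← h2]
  ring

lemma aeval_hermOp_apply {x φ : K} {k : ℕ} (hφ : hermOp D x (2 * k) φ = 0) (p : Polynomial ℤ) :
    Polynomial.aeval (hermOp D x 0) p φ = ((p.eval (-2 * (k : ℤ)) : ℤ) : K) * φ := by
  rw [Module.End.aeval_apply_of_mem_apply_eq_smul (μ := -2 * (k : ℤ)), zsmul_eq_mul]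
  simp only [hermOp_apply] at hφ ⊢
  simp
  linear_combination hφ

variable {D}

/-- With g the image of φ_j under the operator M₀ of the other seeds, and u = g'/g, the factors N =
D - u and N' = D + u - 2x give M = N M₀ and Q = Q₀ N'. The index j is arbitrary so that every
omitted Wronskian can be reached as the seed family before the last step. -/
lemma IsDarboux.step [CharZero K] {x : K} {m : ℕ} {φ : Fin (m + 1) → K} {k : Fin (m + 1) → ℕ}
    (hx : D x = 1) (hk : Function.Injective k) (hφ : ∀ i, hermOp D x (2 * k i) (φ i) = 0)
    (j : Fin (m + 1)) (hj : φ j ≠ 0)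
    (h : IsDarboux D x (fun i => φ (j.succAbove i)) (fun i => k (j.succAbove i))) :
    IsDarboux D x φ k ∧ ∃ Q, IsMonic D (m + 1) Q ∧
      Q * darbouxOp D φ = Polynomial.aeval (hermOp D x 0) (shiftPoly k) ∧
      ∀ E, D E = 2 * x * E → Q (E * wr D (fun i => φ (j.succAbove i)) / wr D φ) = 0 := by
  obtain ⟨h0, ⟨Q₀, hQ₀, hQM⟩, hint⟩ := h
  set φ₀ : Fin m → K := fun i => φ (j.succAbove i) with hφ₀
  set M₀ := darbouxOp D φ₀ with hM₀
  set g := M₀ (φ j) with hg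
  set s : K := (-1) ^ (m + j : ℕ) with hs
  have hs0 : s ≠ 0 := pow_ne_zero _ (by norm_num)
  have hDs : D s = 0 := by
    rcases neg_one_pow_eq_or K (m + j : ℕ) with h | h <;> rw [hs, h] <;> simp
  have hwr : wr D φ = s * wr D φ₀ * g := by
    rw [wr_eq_wrOp_succAbove D φ j, ← hs, ← hφ₀, hg, hM₀, darbouxOp, LinearMap.smul_apply,
      smul_eq_mul]
    field_simp
  -- If g = 0, then Q₀ M₀ also kills φ_j; but it multiplies φ_j by ∏ (2 k_i - 2 k_j) over i ≠ j,
  -- which is nonzero because the k_i are distinct.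
  have hg0 : g ≠ 0 := by
    intro hg0
    have h1 := congrArg (fun F : Module.End ℤ K => F (φ j)) hQM
    simp only [Module.End.mul_apply, ← hg, hg0, map_zero, aeval_hermOp_apply D (hφ j)] at h1
    have h2 : (Polynomial.eval (-2 * (k j : ℤ)) (shiftPoly fun i => k (j.succAbove i))) ≠ 0 := by
      rw [shiftPoly, Polynomial.eval_prod, Finset.prod_ne_zero_iff]
      intro i _
      have := hk.ne (j.succAbove_ne i)
      simp
      omega
    exact mul_ne_zero (Int.cast_ne_zero.2 h2) hj h1.symm
  have hη : wr D φ ≠ 0 := by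
    rw [hwr]; exact mul_ne_zero (mul_ne_zero hs0 h0) hg0
  set u := D g / g with hu
  set b₀ := darbouxPot D φ₀ with hb₀
  have hgu : D g = u * g := by rw [hu]; field_simp
  -- By intertwining, g is an eigenfunction of the transformed operator with the eigenvalue of φ_j.
  have hTg : D (D g) - 2 * x * D g + (b₀ + 2 * k j) * g = 0 := by
    have h1 := congrArg (fun F : Module.End ℤ K => F (φ j)) hint
    have h2 : hermOp D x 0 (φ j) = -((2 * k j : ℤ) • φ j) := by
      have := hφ j
      simp only [hermOp_apply] at this ⊢
      simp
      linear_combination this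
    simp only [Module.End.mul_apply, h2, map_neg, map_zsmul, ← hg, hermOp_apply] at h1
    simp at h1
    linear_combination -h1
  have hric : D u + u ^ 2 - 2 * x * u + b₀ + 2 * k j = 0 := by
    have h1 : D (D g) = (D u + u ^ 2) * g := by
      rw [hgu, Derivation.leibniz, hgu]
      simp only [smul_eq_mul]
      ring
    rw [h1, hgu] at hTg
    have h2 : (D u + u ^ 2 - 2 * x * u + b₀ + 2 * k j) * g = 0 := by linear_combination hTg
    exact (mul_eq_zero.1 h2).resolve_right hg0
  set N : Module.End ℤ K := dOp D + (-u) • 1 with hN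
  set N' : Module.End ℤ K := dOp D + (u - 2 * x) • 1 with hN'
  have hN'N : N' * N = hermOp D x (b₀ + 2 * k j) := by
    ext y
    simp [hN, hN']
    linear_combination -y * hric
  have hM : darbouxOp D φ = N * M₀ := by
    symm
    refine IsMonic.eq_wrOp hη ?_ fun i => ?_
    · rw [add_comm]
      exact (isMonic_dOp_add D _).mul (isMonic_wrOp D h0)
    · rw [Module.End.mul_apply]
      induction i using j.succAboveCases with
      | x => simp [← hg, hN, hgu]
      | p i => rw [hM₀, darbouxOp_apply_self D φ₀ i, map_zero]
  have hQ : Q₀ * N' * darbouxOp D φ = Polynomial.aeval (hermOp D x 0) (shiftPoly k) := by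
    have h1 : hermOp D x (b₀ + 2 * k j) * M₀ = M₀ * hermOp D x (0 + 2 * k j) := by
      rw [← aeval_hermOp_X_add_C, ← aeval_hermOp_X_add_C, mul_aeval_of_mul_eq hint]
    rw [hM, mul_assoc, ← mul_assoc N', hN'N, h1, ← mul_assoc, hQM, ← aeval_hermOp_X_add_C,
      ← map_mul, shiftPoly, shiftPoly, Fin.prod_univ_succAbove _ j, mul_comm]
  have hQmon : IsMonic D (m + 1) (Q₀ * N') := hQ₀.mul (isMonic_dOp_add D _)
  have hpot : darbouxPot D φ = b₀ - 2 + 2 * D u := by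
    have h1 : D (wr D φ) / wr D φ = D (wr D φ₀) / wr D φ₀ + u := by
      rw [hwr]
      simp only [Derivation.leibniz, hDs, smul_eq_mul, hgu]
      field_simp
      ring
    rw [darbouxPot, h1, hb₀, darbouxPot, map_add]
    push_cast
    ring
  refine ⟨⟨hη, ⟨_, hQmon, hQ⟩, ?_⟩, _, hQmon, hQ, fun E hE => ?_⟩
  · have h2 : N * hermOp D x b₀ = hermOp D x (darbouxPot D φ) * N := by
      -- The zeroth order part of the intertwining relation for N is the derivative of the Riccati
      -- equation.
      have h3 := congrArg D hric
      simp only [map_add, map_sub, Derivation.leibniz, pow_two, smul_eq_mul, hx, map_zero,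
        Derivation.map_natCast] at h3
      have h4 : D (2 : K) = 0 := by simpa using Derivation.map_natCast D 2
      ext y
      simp [hN, hpot, h4, hx]
      simp only [h4] at h3
      linear_combination y * h3
    rw [hM, mul_assoc, hint, ← mul_assoc, h2, mul_assoc]
  · have h3 : E * wr D φ₀ / wr D φ = s⁻¹ * E / g := by
      rw [hwr]; field_simp
    -- Up to a constant sign the argument is E/g, and (E/g)' = (2x - u) E/g.
    have h4 : N' (E * wr D φ₀ / wr D φ) = 0 := by
      have hDs' : D s⁻¹ = 0 := by rw [Derivation.leibniz_inv, hDs, smul_zero]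
      rw [h3]
      simp only [hN', LinearMap.add_apply, dOp_apply, LinearMap.smul_apply, Module.End.one_apply,
        div_eq_mul_inv, Derivation.leibniz, Derivation.leibniz_inv, smul_eq_mul, hE, hgu, hDs']
      field_simp
      ring
    rw [Module.End.mul_apply, h4, map_zero]

theorem isDarboux [CharZero K] {x : K} (hx : D x = 1) {m : ℕ} {φ : Fin m → K} {k : Fin m → ℕ}
    (hk : Function.Injective k) (hφ : ∀ i, hermOp D x (2 * k i) (φ i) = 0) (h0 : ∀ i, φ i ≠ 0) :
    IsDarboux D x φ k := by
  induction m with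
  | zero =>
    have hwr : wr D φ = 1 := by simp [wr]
    have hM : darbouxOp D φ = 1 := by
      ext y
      simp [darbouxOp, wrOp, wr]
    refine ⟨by simp [hwr], ⟨1, isMonic_one D, by simp [hM, shiftPoly]⟩, ?_⟩
    simp [hM, darbouxPot, hwr]
  | succ m ih =>
    exact (IsDarboux.step hx hk hφ (Fin.last m) (h0 _)
      (ih (hk.comp Fin.succAbove_right_injective) (fun i => hφ _) fun i => h0 _)).1

/-- The left factor annihilates the transformed dual seeds. -/
theorem exists_darboux_factor [CharZero K] {x : K} (hx : D x = 1) {m : ℕ} {φ : Fin (m + 1) → K}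
    {k : Fin (m + 1) → ℕ} (hk : Function.Injective k)
    (hφ : ∀ i, hermOp D x (2 * k i) (φ i) = 0) (h0 : ∀ i, φ i ≠ 0) :
    ∃ Q, IsMonic D (m + 1) Q ∧
      Q * darbouxOp D φ = Polynomial.aeval (hermOp D x 0) (shiftPoly k) ∧
      ∀ E, D E = 2 * x * E → ∀ j : Fin (m + 1),
        Q (E * wr D (fun i => φ (j.succAbove i)) / wr D φ) = 0 := by
  have key := fun j : Fin (m + 1) => (IsDarboux.step hx hk hφ j (h0 j)
    (isDarboux hx (hk.comp Fin.succAbove_right_injective) (fun i => hφ _) fun i => h0 _)).2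
  have hη := (isDarboux hx hk hφ h0).wr_ne_zero
  obtain ⟨Q, hQ, hQM, -⟩ := key 0
  refine ⟨Q, hQ, hQM, fun E hE j => ?_⟩
  obtain ⟨Q', hQ', hQM', hker⟩ := key j
  -- The left factors obtained from different last seeds coincide, because each composes with the
  -- same monic operator to the same product.
  rw [(isMonic_wrOp D hη).mul_right_cancel hx hQ.mem_opLT hQ'.mem_opLT (hQM.trans hQM'.symm)]
  exact hker E hE

/-- Composing the two factors in the other order gives the Darboux transformed polynomial. -/
theorem IsDarboux.mul_factor [CharZero K] {x : K} (hx : D x = 1) {m : ℕ} {φ : Fin m → K}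
    {k : Fin m → ℕ} (h : IsDarboux D x φ k) {Q : Module.End ℤ K} (hQ : IsMonic D m Q)
    (hQM : Q * darbouxOp D φ = Polynomial.aeval (hermOp D x 0) (shiftPoly k)) :
    darbouxOp D φ * Q = Polynomial.aeval (hermOp D x (darbouxPot D φ)) (shiftPoly k) := by
  have hM := isMonic_wrOp D h.wr_ne_zero
  obtain ⟨n, hn⟩ := exists_aeval_mem_opLT D (hermOp_mem_opLT D x (darbouxPot D φ)) (shiftPoly k)
  refine hM.mul_right_cancel hx (m := max (m + 1 + m) n)
    (opLT_mono D (le_max_left _ _) (mul_mem_opLT D hM.mem_opLT hQ.mem_opLT))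
    (opLT_mono D (le_max_right _ _) hn) ?_
  change darbouxOp D φ * Q * darbouxOp D φ = _ * darbouxOp D φ
  rw [mul_assoc, hQM, mul_aeval_of_mul_eq h.intertwine]

end DiffOp

/-! ### Wronskians of omitted Wronskians and the dual operator. -/

namespace DiffOp

open Matrix

/-- Reversal followed by the cyclic rotation fixes 0 and reverses the remaining n points. -/
lemma sign_revPerm_succ (n : ℕ) :
    Equiv.Perm.sign (Fin.revPerm : Equiv.Perm (Fin (n + 1))) =
      (-1) ^ n * Equiv.Perm.sign (Fin.revPerm : Equiv.Perm (Fin n)) := by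
  have h : finRotate (n + 1) * (Fin.revPerm : Equiv.Perm (Fin (n + 1))) =
      Equiv.Perm.decomposeFin.symm (0, (Fin.revPerm : Equiv.Perm (Fin n))) := by
    ext i
    refine Fin.cases ?_ (fun i => ?_) i
    · simp
    · have : Fin.rev i.succ = (Fin.rev i).castSucc := by simp [Fin.rev_succ]
      simp [this]
  have h2 := congrArg Equiv.Perm.sign h
  rw [Equiv.Perm.sign_mul, sign_finRotate, Equiv.Perm.decomposeFin.symm_sign, if_pos rfl,
    one_mul] at h2
  rw [← h2, Nat.add_sub_cancel, ← mul_assoc, ← pow_add, ← two_mul, pow_mul]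
  simp

lemma sign_revPerm (n : ℕ) :
    Equiv.Perm.sign (Fin.revPerm : Equiv.Perm (Fin n)) = (-1) ^ (n / 2) := by
  induction n using Nat.twoStepInduction with
  | zero => rw [Subsingleton.elim Fin.revPerm (1 : Equiv.Perm (Fin 0))]; simp
  | one => rw [Subsingleton.elim Fin.revPerm (1 : Equiv.Perm (Fin 1))]; simp
  | more n ih _ =>
    rw [sign_revPerm_succ, sign_revPerm_succ, ih, show (n + 2) / 2 = n / 2 + 1 by omega, pow_succ,
      pow_succ]
    rcases neg_one_pow_eq_or ℤˣ n with h | h <;> simp [h]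

variable {K : Type*} [Field K] (D : Derivation ℤ K K)

lemma dOp_pow_mul_smul_one_sub_mem (g : K) (i : ℕ) :
    dOp D ^ i * (g • (1 : Module.End ℤ K)) - g • dOp D ^ i ∈ opLT D i := by
  induction i with
  | zero => simp
  | succ i ih =>
    have h : dOp D ^ (i + 1) * (g • (1 : Module.End ℤ K)) - g • dOp D ^ (i + 1) =
        dOp D * (dOp D ^ i * (g • (1 : Module.End ℤ K)) - g • dOp D ^ i) + D g • dOp D ^ i := by
      rw [mul_sub, dOp_mul_smul, pow_succ', mul_assoc]
      abel
    rw [h]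
    exact add_mem (dOp_mul_mem_opLT D ih)
      (Submodule.smul_mem _ _ (dOp_pow_mem_opLT D (Nat.lt_succ_self i)))

lemma exists_iterate_mul_eq (g : K) (i : ℕ) : ∃ c : ℕ → K, ∀ y,
    D^[i] (g * y) = g * D^[i] y + ∑ k ∈ Finset.range i, c k * D^[k] y := by
  obtain ⟨c, hc⟩ := exists_coeff_of_mem_opLT D (dOp_pow_mul_smul_one_sub_mem D g i)
  refine ⟨fun k => if h : k < i then c ⟨k, h⟩ else 0, fun y => ?_⟩
  have h := congrArg (fun F : Module.End ℤ K => F y) hc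
  simp only [LinearMap.sub_apply, Module.End.mul_apply, LinearMap.smul_apply, LinearMap.sum_apply,
    Module.End.one_apply, dOp_pow_apply, smul_eq_mul] at h
  rw [← Fin.sum_univ_eq_sum_range
    (fun k => (if h : k < i then c ⟨k, h⟩ else 0) * D^[k] y) i, ← sub_eq_iff_eq_add', h]
  exact Finset.sum_congr rfl fun k _ => by simp

/-- Scaling property of Wronskians. -/
lemma wr_mul_left {m : ℕ} (g : K) (f : Fin m → K) :
    wr D (fun j => g * f j) = g ^ m * wr D f := by
  choose c hc using exists_iterate_mul_eq D g
  have h : (Matrix.of fun i j : Fin m => D^[(i : ℕ)] (g * f j)) =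
      (Matrix.of fun i k : Fin m => if k < i then c i k else if k = i then g else 0) *
        Matrix.of fun i j : Fin m => D^[(i : ℕ)] (f j) := by
    ext i j
    simp only [Matrix.mul_apply, Matrix.of_apply, hc]
    have h1 : ∀ k : Fin m, (if k < i then c i k else if k = i then g else 0) * D^[(k : ℕ)] (f j) =
        (if k = i then g * D^[(k : ℕ)] (f j) else 0) +
          if (k : ℕ) < i then c i k * D^[(k : ℕ)] (f j) else 0 := by
      intro k
      rcases lt_trichotomy k i with h | h | h
      · simp [h, h.ne]
      · simp [h]
      · simp [h.ne', h.not_gt]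
    rw [Finset.sum_congr rfl fun k _ => h1 k, Finset.sum_add_distrib, Finset.sum_ite_eq',
      if_pos (Finset.mem_univ _),
      Fin.sum_univ_eq_sum_range (fun k => if k < (i : ℕ) then c i k * D^[k] (f j) else 0) m,
      ← Finset.sum_filter]
    congr 2
    ext k
    simp
    omega
  rw [wr, h, Matrix.det_mul, Matrix.det_of_isLowerTriangular, wr]
  · simp
  · intro i k hik
    have hik : i < k := hik
    simp [hik.not_gt, hik.ne']

/-- The Wronskians of a family with one member omitted. -/
def wrOmit : {m : ℕ} → (Fin m → K) → Fin m → K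
  | 0, _, j => j.elim0
  | _ + 1, f, j => wr D fun i => f (j.succAbove i)

/-- The signed omitted Wronskians are the cofactors of the last row; for i < m the sum is a
determinant with a repeated row. -/
lemma sum_iterate_mul_signed_wrOmit {m : ℕ} (f : Fin (m + 1) → K) {i : ℕ} (hi : i ≤ m) :
    ∑ j : Fin (m + 1), D^[i] (f j) * ((-1) ^ (m + j : ℕ) * wrOmit D f j) = if i = m then wr D f else 0 := by
  have h : ((Matrix.of fun a b : Fin (m + 1) => D^[(a : ℕ)] (f b)).updateRow (Fin.last m)
      (fun j => D^[i] (f j))).det = if i = m then wr D f else 0 := by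
    split_ifs with him
    · subst him
      rw [wr]
      congr 1
      ext a b
      refine Fin.lastCases ?_ (fun a => ?_) a
      · simp
      · simp
    · have hne : (⟨i, by omega⟩ : Fin (m + 1)) ≠ Fin.last m := fun h => him (congrArg Fin.val h)
      exact Matrix.det_updateRow_eq_zero hne
  rw [← h, Matrix.det_succ_row _ (Fin.last m)]
  refine Finset.sum_congr rfl fun j _ => ?_
  have h1 : (((Matrix.of fun a b : Fin (m + 1) => D^[(a : ℕ)] (f b)).updateRow (Fin.last m)
      (fun j => D^[i] (f j))).submatrix (Fin.last m).succAbove j.succAbove) =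
      Matrix.of fun a b : Fin m => D^[(a : ℕ)] (f (j.succAbove b)) := by
    ext a b
    simp
  rw [h1]
  simp [wrOmit, wr]
  ring

/-- Differentiating a vanishing sum moves one derivative from f to the cofactors at the cost of a
sign. -/
lemma sum_iterate_mul_iterate_wrOmit {m : ℕ} (f : Fin (m + 1) → K) (p : ℕ) :
    ∀ i, i + p ≤ m →
      ∑ j : Fin (m + 1), D^[i] (f j) * D^[p] ((-1) ^ (m + j : ℕ) * wrOmit D f j) =
        if i + p = m then (-1) ^ p * wr D f else 0 := by
  induction p with
  | zero =>
    intro i hi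
    simpa using sum_iterate_mul_signed_wrOmit D f hi
  | succ p ih =>
    intro i hi
    have h1 := congrArg D (ih i (by omega))
    rw [if_neg (by omega), map_zero, map_sum] at h1
    have h2 := ih (i + 1) (by omega)
    simp only [Derivation.leibniz, smul_eq_mul, Finset.sum_add_distrib,
      ← Function.iterate_succ_apply' D] at h1
    have h3 : ∑ j : Fin (m + 1), D^[p] ((-1) ^ (m + j : ℕ) * wrOmit D f j) * D^[i + 1] (f j) =
        if i + 1 + p = m then (-1) ^ p * wr D f else 0 := by
      rw [← h2]
      exact Finset.sum_congr rfl fun j _ => mul_comm _ _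
    rw [h3] at h1
    rw [eq_neg_of_add_eq_zero_left h1, show i + 1 + p = i + (p + 1) by ring]
    split_ifs
    · ring
    · simp

lemma iterate_neg_one_pow_mul (n p : ℕ) (y : K) :
    D^[p] ((-1) ^ n * y) = (-1) ^ n * D^[p] y := by
  rw [← dOp_pow_apply, ← dOp_pow_apply]
  rcases neg_one_pow_eq_or K n with h | h <;> simp [h]

/-- The Wronskian of the Wronskians with one function omitted. -/
lemma wr_mul_wr_wrOmit {m : ℕ} (f : Fin m → K) :
    wr D f * wr D (wrOmit D f) = (-1) ^ (m / 2) * wr D f ^ m := by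
  cases m with
  | zero => simp [wr]
  | succ m =>
    set W : Matrix (Fin (m + 1)) (Fin (m + 1)) K := Matrix.of fun i j => D^[(i : ℕ)] (f j)
    set U : Matrix (Fin (m + 1)) (Fin (m + 1)) K :=
      Matrix.of fun i j => D^[(i : ℕ)] ((-1) ^ (m + j : ℕ) * wrOmit D f j) with hU
    set ε : K := ∏ j : Fin (m + 1), (-1) ^ (m + j : ℕ) with hε
    have hUdet : U.det = ε * wr D (wrOmit D f) := by
      rw [hε, wr, ← Matrix.det_mul_row, hU]
      congr 1
      ext i j
      simp [iterate_neg_one_pow_mul]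
    have hent : ∀ i p : Fin (m + 1), (i : ℕ) + p ≤ m → (W * Uᵀ) i p =
        if (i : ℕ) + p = m then (-1) ^ (p : ℕ) * wr D f else 0 := fun i p hip => by
      rw [← sum_iterate_mul_iterate_wrOmit D f p i hip, Matrix.mul_apply]
      rfl
    -- The product vanishes above its antidiagonal, so reversing the columns makes it lower
    -- triangular. The signs on the diagonal multiply to the ε already present in det U, and only
    -- the sign of the reversal survives.
    have hdet : ((W * Uᵀ).submatrix id (Fin.revPerm : Equiv.Perm (Fin (m + 1)))).det =
        ε * wr D f ^ (m + 1) := by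
      rw [Matrix.det_of_isLowerTriangular]
      · have : ∀ i : Fin (m + 1), (W * Uᵀ).submatrix id Fin.revPerm i i =
            (-1) ^ (m + i : ℕ) * wr D f := fun i => by
          rw [Matrix.submatrix_apply, id, Fin.revPerm_apply,
            hent _ _ (by rw [Fin.val_rev]; omega), if_pos (by rw [Fin.val_rev]; omega),
            Fin.val_rev, show m + (i : ℕ) = (m + 1 - (i + 1)) + 2 * i by omega, pow_add, pow_mul]
          simp
        rw [Finset.prod_congr rfl fun i _ => this i, Finset.prod_mul_distrib]
        simp [hε]
      · intro i p hip
        have hip : i < p := hip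
        have hip' : (i : ℕ) < p := hip
        rw [Matrix.submatrix_apply, id, Fin.revPerm_apply,
          hent _ _ (by rw [Fin.val_rev]; omega), if_neg (by rw [Fin.val_rev]; omega)]
    rw [Matrix.det_permute', Matrix.det_mul, Matrix.det_transpose, hUdet, sign_revPerm] at hdet
    have hε0 : ε ≠ 0 := Finset.prod_ne_zero_iff.2 fun j _ => pow_ne_zero _ (by norm_num)
    have hW : W.det = wr D f := rfl
    rw [hW] at hdet
    have hs : ((-1 : K) ^ ((m + 1) / 2)) * (-1) ^ ((m + 1) / 2) = 1 := by
      rw [← mul_pow]; simp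
    push_cast at hdet
    refine mul_left_cancel₀ hε0 ?_
    linear_combination (-1 : K) ^ ((m + 1) / 2) * hdet - ε * wr D f * wr D (wrOmit D f) * hs

/-- The operator `y ↦ ± E η⁻ᵐ Wr(h̃_1, …, h̃_m, E⁻¹ y)`. -/
def dualOp (E : K) {m : ℕ} (φ : Fin m → K) (y : K) : K :=
  (-1) ^ (m / 2) * E * (wr D φ ^ m)⁻¹ *
    wr D (Fin.snoc (α := fun _ : Fin (m + 1) => K) (wrOmit D φ) (E⁻¹ * y))

variable {D}

/-- Q is the normalized Wronskian operator of the family (E/η) h̃_j. Writing y/η = (E/η)(E⁻¹ y), the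
factor E/η comes out of both Wronskians, leaving one power of it in the quotient. -/
lemma IsMonic.apply_div_wr {m : ℕ} {φ : Fin m → K} (hη : wr D φ ≠ 0) {E : K} (hE : E ≠ 0)
    {Q : Module.End ℤ K} (hQ : IsMonic D m Q)
    (hker : ∀ j, Q (E * wrOmit D φ j / wr D φ) = 0) (y : K) :
    Q (y / wr D φ) = dualOp D E φ y := by
  set η := wr D φ with hη'
  set s : K := (-1) ^ (m / 2) with hs
  have hss : s * s = 1 := by rw [hs, ← mul_pow]; simp
  have hs0 : s ≠ 0 := left_ne_zero_of_mul_eq_one hss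
  have hom : wr D (wrOmit D φ) = s * η ^ m / η := by
    rw [eq_div_iff hη, mul_comm, wr_mul_wr_wrOmit]
  have hf : wr D (fun j => E / η * wrOmit D φ j) = (E / η) ^ m * (s * η ^ m / η) := by
    rw [wr_mul_left, hom]
  have hf0 : wr D (fun j => E / η * wrOmit D φ j) ≠ 0 := by
    rw [hf]
    positivity
  have hsn : (Fin.snoc (fun j => E / η * wrOmit D φ j) (y / η) : Fin (m + 1) → K) =
      fun j => E / η * (Fin.snoc (α := fun _ => K) (wrOmit D φ) (E⁻¹ * y) : Fin (m + 1) → K) j := by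
    funext j
    refine Fin.lastCases ?_ (fun j => ?_) j
    · simp
      field_simp
    · simp
  rw [hQ.eq_wrOp hf0 fun j => by rw [← hker j]; congr 1; ring, LinearMap.smul_apply, wrOp_apply,
    hsn, hf, wr_mul_left, dualOp, smul_eq_mul, ← hη', ← hs]
  field_simp
  rw [pow_two, hss, pow_succ]
  field_simp

end DiffOp

/-! ### The two compositions in a differential field. -/

namespace DiffOp

open Matrix

section Algebra

variable {K : Type*} [Field K] (D : Derivation ℤ K K)

/-- The operator `y ↦ y'' - 2 (x + η' / η) y' + (η'' / η + 2 x η' / η + c) y`. -/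
def hatOp (x η c : K) : Module.End ℤ K :=
  dOp D * dOp D - (2 * (x + D η / η)) • dOp D + (D (D η) / η + 2 * x * (D η / η) + c) • 1

@[simp] lemma hatOp_apply (x η c y : K) : hatOp D x η c y =
    D (D y) - 2 * (x + D η / η) * D y + (D (D η) / η + 2 * x * (D η / η) + c) * y := by
  simp [hatOp]

/-- This is the gauge transformation by η that carries the Darboux transformed operator to T̂ - 2m.
-/
lemma smul_hermOp_eq {m : ℕ} {x : K} {φ : Fin m → K} (hη : wr D φ ≠ 0) :
    (wr D φ • (1 : Module.End ℤ K)) * hermOp D x (darbouxPot D φ) =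
      hatOp D x (wr D φ) (-2 * m) * (wr D φ • 1) := by
  ext y
  simp only [darbouxPot, Module.End.mul_apply, LinearMap.smul_apply, Module.End.one_apply,
    hermOp_apply, hatOp_apply, smul_eq_mul, Derivation.leibniz, Derivation.leibniz_div, map_add]
  field_simp
  ring

lemma aeval_shiftPoly_apply {m : ℕ} {k : Fin m → ℕ} (S : Module.End ℤ K) (y : K) :
    Polynomial.aeval S (shiftPoly k) y =
      ExceptionalHermite.compose (fun i : Fin m => fun z => S z + 2 * (k i : K) * z) y := by
  have h : ∀ l : List ℕ, Polynomial.aeval S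
      ((l.map fun a : ℕ => Polynomial.X + Polynomial.C (2 * (a : ℤ))).prod) y =
        (l.map fun a : ℕ => fun z : K => S z + 2 * (a : K) * z).foldr (fun U V => U ∘ V) id y := by
    intro l
    induction l with
    | nil => simp
    | cons a l ih =>
      rw [List.map_cons, List.prod_cons, map_mul, Module.End.mul_apply, ih, map_add,
        Polynomial.aeval_X, Polynomial.aeval_C, LinearMap.add_apply, Module.algebraMap_end_apply]
      simp
  rw [ExceptionalHermite.compose, shiftPoly, ← List.prod_ofFn]
  have := h (List.ofFn k)
  rwa [List.map_ofFn, List.map_ofFn] at this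

variable {D}

variable [CharZero K] {x : K} {m : ℕ} {φ : Fin m → K} {k : Fin m → ℕ}

lemma IsDarboux.exists_dual (hx : D x = 1) (hk : Function.Injective k)
    (hφ : ∀ i, hermOp D x (2 * k i) (φ i) = 0) (h0 : ∀ i, φ i ≠ 0) {E : K} (hE0 : E ≠ 0)
    (hE : D E = 2 * x * E) : ∃ Q, IsMonic D m Q ∧
      Q * darbouxOp D φ = Polynomial.aeval (hermOp D x 0) (shiftPoly k) ∧
      ∀ y, Q (y / wr D φ) = dualOp D E φ y := by
  have hD := isDarboux hx hk hφ h0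
  cases m with
  | zero =>
    obtain ⟨Q, hQ, hQM⟩ := hD.factor
    exact ⟨Q, hQ, hQM, hQ.apply_div_wr hD.wr_ne_zero hE0 fun j => j.elim0⟩
  | succ m =>
    obtain ⟨Q, hQ, hQM, hker⟩ := exists_darboux_factor hx hk hφ h0
    exact ⟨Q, hQ, hQM, hQ.apply_div_wr hD.wr_ne_zero hE0 (hker E hE)⟩

theorem dualOp_wrOp (hx : D x = 1) (hk : Function.Injective k)
    (hφ : ∀ i, hermOp D x (2 * k i) (φ i) = 0) (h0 : ∀ i, φ i ≠ 0) {E : K} (hE0 : E ≠ 0)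
    (hE : D E = 2 * x * E) (y : K) :
    dualOp D E φ (wrOp D φ y) = Polynomial.aeval (hermOp D x 0) (shiftPoly k) y := by
  obtain ⟨Q, -, hQM, hQ⟩ := IsDarboux.exists_dual hx hk hφ h0 hE0 hE
  rw [← hQ, ← hQM, Module.End.mul_apply, darbouxOp, LinearMap.smul_apply, smul_eq_mul,
    div_eq_inv_mul]

theorem wrOp_dualOp (hx : D x = 1) (hk : Function.Injective k)
    (hφ : ∀ i, hermOp D x (2 * k i) (φ i) = 0) (h0 : ∀ i, φ i ≠ 0) {E : K} (hE0 : E ≠ 0)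
    (hE : D E = 2 * x * E) (y : K) :
    wrOp D φ (dualOp D E φ y) =
      Polynomial.aeval (hatOp D x (wr D φ) (-2 * m)) (shiftPoly k) y := by
  have hD := isDarboux hx hk hφ h0
  have hη := hD.wr_ne_zero
  obtain ⟨Q, hQmon, hQM, hQ⟩ := IsDarboux.exists_dual hx hk hφ h0 hE0 hE
  have h1 : wrOp D φ = (wr D φ • (1 : Module.End ℤ K)) * darbouxOp D φ := by
    ext z
    simp [darbouxOp, hη]
  have h2 : y = (wr D φ • (1 : Module.End ℤ K)) (y / wr D φ) := by
    simp [mul_div_cancel₀, hη]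
  conv_rhs => rw [h2]
  rw [← hQ, h1, ← Module.End.mul_apply, ← Module.End.mul_apply, mul_assoc,
    hD.mul_factor hx hQmon hQM, mul_aeval_of_mul_eq (smul_hermOp_eq D hη)]

end Algebra

/-! ### Extending a derivation to the fraction field. -/

section FractionField

variable {R : Type*} [CommRing R] [IsDomain R] {A : Type*} [CommRing A]
  [Algebra A R] (d : Derivation A R R)
  (K : Type*) [Field K] [Algebra R K] [IsFractionRing R K]

/-- The ring homomorphism `r ↦ r + r' ε` to the dual numbers. -/
def dualHom : R →+* TrivSqZeroExt K K where
  toFun r := TrivSqZeroExt.inl (algebraMap R K r) + TrivSqZeroExt.inr (algebraMap R K (d r))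
  map_one' := by ext <;> simp
  map_mul' a b := by ext <;> simp [mul_comm, -DualNumber.inr_eq_smul_eps]
  map_zero' := by ext <;> simp
  map_add' a b := by ext <;> simp [-DualNumber.inr_eq_smul_eps]

/-- The extension of `dualHom` to the fraction field. -/
noncomputable def fracDualHom : K →+* TrivSqZeroExt K K :=
  IsLocalization.lift (M := nonZeroDivisors R) (g := dualHom d K) fun r => by
    -- Invertibility of r + r' ε depends only on r, so the map localizes; its second component then
    -- gives the quotient rule for free.
    rw [TrivSqZeroExt.isUnit_iff_isUnit_fst]
    simp [dualHom]

lemma fracDualHom_algebraMap (r : R) : fracDualHom d K (algebraMap R K r) = dualHom d K r :=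
  IsLocalization.lift_eq _ _

lemma fst_fracDualHom (a : K) : (fracDualHom d K a).fst = a := by
  have h : ((TrivSqZeroExt.fstHom K K K : TrivSqZeroExt K K →+* K).comp (fracDualHom d K)) =
      RingHom.id K := by
    refine IsLocalization.ringHom_ext (nonZeroDivisors R) (RingHom.ext fun r => ?_)
    simp [fracDualHom_algebraMap, dualHom]
  exact congrArg (fun F : K →+* K => F a) h

/-- The extension of a derivation to the fraction field. -/
noncomputable def fracDeriv : Derivation ℤ K K :=
  Derivation.mk' (AddMonoidHom.toIntLinearMap
    { toFun := fun a => (fracDualHom d K a).snd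
      map_zero' := by simp
      map_add' := by simp }) fun a b => by
    simp [fst_fracDualHom]
    ring

@[simp] lemma fracDeriv_algebraMap (r : R) :
    fracDeriv d K (algebraMap R K r) = algebraMap R K (d r) := by
  change (fracDualHom d K (algebraMap R K r)).snd = _
  simp [fracDualHom_algebraMap, dualHom, -DualNumber.inr_eq_smul_eps]

end FractionField

end DiffOp

/-! ### Jets of functions as formal power series. -/

namespace ExceptionalHermite

open PowerSeries Filter Topology DiffOp

variable {𝕜 : Type*} [RCLike 𝕜]

/-- The function `f` is `n` times continuously differentiable at `x₀`, and the power series `F`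
agrees with the Taylor expansion of `f` at `x₀` to order `n`. -/
def HasPowerJet (x₀ : 𝕜) (n : ℕ) (f : 𝕜 → 𝕜) (F : 𝕜⟦X⟧) : Prop :=
  ContDiffAt 𝕜 n f x₀ ∧ ∀ i ≤ n, iteratedDeriv i f x₀ = constantCoeff ((d⁄dX 𝕜)^[i] F)

variable {x₀ : 𝕜}

lemma HasPowerJet.mono {m n : ℕ} (hmn : m ≤ n) {f : 𝕜 → 𝕜} {F : 𝕜⟦X⟧}
    (hf : HasPowerJet x₀ n f F) : HasPowerJet x₀ m f F :=
  ⟨hf.1.of_le (by exact_mod_cast hmn), fun i hi => hf.2 i (hi.trans hmn)⟩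

lemma HasPowerJet.congr {n : ℕ} {f g : 𝕜 → 𝕜} {F : 𝕜⟦X⟧} (hf : HasPowerJet x₀ n f F)
    (hfg : g =ᶠ[𝓝 x₀] f) : HasPowerJet x₀ n g F :=
  ⟨hf.1.congr_of_eventuallyEq hfg, fun i hi => by rw [hfg.iteratedDeriv_eq, hf.2 i hi]⟩

lemma HasPowerJet.eval {n : ℕ} {f : 𝕜 → 𝕜} {F : 𝕜⟦X⟧} (hf : HasPowerJet x₀ n f F) :
    f x₀ = constantCoeff F := by
  simpa using hf.2 0 (Nat.zero_le n)

lemma hasPowerJet_zero_iff {f : 𝕜 → 𝕜} {F : 𝕜⟦X⟧} :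
    HasPowerJet x₀ 0 f F ↔ ContDiffAt 𝕜 0 f x₀ ∧ f x₀ = constantCoeff F := by
  constructor
  · exact fun h => ⟨by simpa using h.1, h.eval⟩
  · rintro ⟨h, h'⟩
    refine ⟨by simpa using h, fun i hi => ?_⟩
    obtain rfl : i = 0 := by omega
    simpa using h'

lemma HasPowerJet.deriv {n : ℕ} {f : 𝕜 → 𝕜} {F : 𝕜⟦X⟧} (hf : HasPowerJet x₀ (n + 1) f F) :
    HasPowerJet x₀ n (deriv f) (d⁄dX 𝕜 F) := by
  refine ⟨hf.1.derivWithin (by norm_cast), fun i hi => ?_⟩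
  rw [← iteratedDeriv_succ', hf.2 (i + 1) (by omega), Function.iterate_succ_apply]

lemma HasPowerJet.of_deriv {n : ℕ} {f : 𝕜 → 𝕜} {F : 𝕜⟦X⟧} (hf : ContDiffAt 𝕜 (n + 1 : ℕ) f x₀)
    (h0 : f x₀ = constantCoeff F) (h : HasPowerJet x₀ n (_root_.deriv f) (d⁄dX 𝕜 F)) :
    HasPowerJet x₀ (n + 1) f F := by
  refine ⟨hf, fun i hi => ?_⟩
  cases i with
  | zero => simpa using h0
  | succ i => rw [iteratedDeriv_succ', h.2 i (by omega), Function.iterate_succ_apply]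

lemma eventually_differentiableAt {n : ℕ} {f : 𝕜 → 𝕜} (hf : ContDiffAt 𝕜 (n + 1 : ℕ) f x₀) :
    ∀ᶠ t in 𝓝 x₀, DifferentiableAt 𝕜 f t :=
  (hf.eventually (by simp)).mono fun _ ht => ht.differentiableAt (by simp)

lemma HasPowerJet.add {n : ℕ} {f g : 𝕜 → 𝕜} {F G : 𝕜⟦X⟧} (hf : HasPowerJet x₀ n f F)
    (hg : HasPowerJet x₀ n g G) : HasPowerJet x₀ n (fun t => f t + g t) (F + G) := by
  induction n generalizing f g F G with
  | zero => exact hasPowerJet_zero_iff.2 ⟨by simpa using hf.1.add hg.1, by simp [hf.eval, hg.eval]⟩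
  | succ n ih =>
    refine .of_deriv (hf.1.add hg.1) (by simp [hf.eval, hg.eval]) ?_
    rw [map_add]
    refine (ih hf.deriv hg.deriv).congr ?_
    filter_upwards [eventually_differentiableAt hf.1, eventually_differentiableAt hg.1] with t h1 h2
    exact deriv_fun_add h1 h2

lemma HasPowerJet.mul {n : ℕ} {f g : 𝕜 → 𝕜} {F G : 𝕜⟦X⟧} (hf : HasPowerJet x₀ n f F)
    (hg : HasPowerJet x₀ n g G) : HasPowerJet x₀ n (fun t => f t * g t) (F * G) := by
  induction n generalizing f g F G with
  | zero => exact hasPowerJet_zero_iff.2 ⟨by simpa using hf.1.mul hg.1, by simp [hf.eval, hg.eval]⟩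
  | succ n ih =>
    refine .of_deriv (hf.1.mul hg.1) (by simp [hf.eval, hg.eval]) ?_
    have h : d⁄dX 𝕜 (F * G) = d⁄dX 𝕜 F * G + F * d⁄dX 𝕜 G := by
      rw [Derivation.leibniz, smul_eq_mul, smul_eq_mul]; ring
    rw [h]
    refine ((ih hf.deriv (hg.mono n.le_succ)).add (ih (hf.mono n.le_succ) hg.deriv)).congr ?_
    filter_upwards [eventually_differentiableAt hf.1, eventually_differentiableAt hg.1] with t h1 h2
    exact deriv_fun_mul h1 h2

lemma hasPowerJet_const (n : ℕ) (c : 𝕜) : HasPowerJet x₀ n (fun _ => c) (C c) := by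
  refine ⟨contDiffAt_const, fun i _ => ?_⟩
  rw [iteratedDeriv_const]
  cases i with
  | zero => simp
  | succ i =>
    have : ∀ i : ℕ, (d⁄dX 𝕜)^[i] (0 : 𝕜⟦X⟧) = 0 := fun i => by
      induction i with
      | zero => rfl
      | succ i ih => rw [Function.iterate_succ_apply, map_zero, ih]
    simp [this]

lemma HasPowerJet.inv {n : ℕ} {f : 𝕜 → 𝕜} {F : 𝕜⟦X⟧} (hf : HasPowerJet x₀ n f F)
    (h0 : f x₀ ≠ 0) : HasPowerJet x₀ n (fun t => (f t)⁻¹) F⁻¹ := by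
  induction n with
  | zero => exact hasPowerJet_zero_iff.2 ⟨ContDiffAt.inv (by simpa using hf.1) h0, by simp [hf.eval]⟩
  | succ n ih =>
    refine .of_deriv (hf.1.inv h0) (by simp [hf.eval]) ?_
    have h1 := ih (hf.mono n.le_succ)
    have h2 : d⁄dX 𝕜 F⁻¹ = C (-1) * (F⁻¹ * F⁻¹ * d⁄dX 𝕜 F) := by
      rw [derivative_inv', map_neg, map_one]; ring
    rw [h2]
    refine ((hasPowerJet_const n (-1)).mul ((h1.mul h1).mul hf.deriv)).congr ?_
    filter_upwards [eventually_differentiableAt hf.1, hf.1.continuousAt.eventually_ne h0]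
      with t ht ht0
    rw [deriv_fun_inv'' ht ht0]
    field_simp

/-- Coefficients beyond degree n are unconstrained, so any values serve there. -/
lemma ContDiffAt.exists_hasPowerJet {n : ℕ} {f : 𝕜 → 𝕜} (hf : ContDiffAt 𝕜 n f x₀) :
    HasPowerJet x₀ n f (PowerSeries.mk fun i => iteratedDeriv i f x₀ / (i.factorial : 𝕜)) := by
  refine ⟨hf, fun i _ => ?_⟩
  rw [constantCoeff_iterate_derivative, coeff_mk, mul_div_cancel₀]
  exact_mod_cast i.factorial_ne_zero

lemma HasPowerJet.unique {f : 𝕜 → 𝕜} {F G : 𝕜⟦X⟧} (hF : ∀ n, HasPowerJet x₀ n f F)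
    (hG : ∀ n, HasPowerJet x₀ n f G) : F = G := by
  ext n
  have h := ((hF n).2 n le_rfl).symm.trans ((hG n).2 n le_rfl)
  rw [constantCoeff_iterate_derivative, constantCoeff_iterate_derivative] at h
  exact mul_left_cancel₀ (by exact_mod_cast n.factorial_ne_zero) h

/-- The fraction field of the ring of formal power series. -/
def SeriesField (𝕜 : Type*) [RCLike 𝕜] : Type _ := FractionRing 𝕜⟦X⟧

noncomputable instance : Field (SeriesField 𝕜) := inferInstanceAs (Field (FractionRing 𝕜⟦X⟧))

noncomputable instance : Algebra 𝕜⟦X⟧ (SeriesField 𝕜) :=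
  inferInstanceAs (Algebra 𝕜⟦X⟧ (FractionRing 𝕜⟦X⟧))

instance : IsFractionRing 𝕜⟦X⟧ (SeriesField 𝕜) :=
  inferInstanceAs (IsFractionRing 𝕜⟦X⟧ (FractionRing 𝕜⟦X⟧))

instance : CharZero (SeriesField 𝕜) :=
  charZero_of_injective_ringHom
    ((algebraMap 𝕜⟦X⟧ (SeriesField 𝕜)).comp (C : 𝕜 →+* 𝕜⟦X⟧)).injective

/-- The derivation of the fraction field of the ring of formal power series. -/
noncomputable def seriesDeriv (𝕜 : Type*) [RCLike 𝕜] :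
    Derivation ℤ (SeriesField 𝕜) (SeriesField 𝕜) :=
  fracDeriv (d⁄dX 𝕜) (SeriesField 𝕜)

/-- Jets of functions, as elements of the fraction field. -/
def HasJet (x₀ : 𝕜) (n : ℕ) (f : 𝕜 → 𝕜) (F : SeriesField 𝕜) : Prop :=
  ∃ F₀ : 𝕜⟦X⟧, algebraMap _ (SeriesField 𝕜) F₀ = F ∧ HasPowerJet x₀ n f F₀

namespace HasJet

variable {n : ℕ} {f g : 𝕜 → 𝕜} {F G : SeriesField 𝕜}

lemma mono {m : ℕ} (hmn : m ≤ n) (hf : HasJet x₀ n f F) : HasJet x₀ m f F := by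
  obtain ⟨F₀, rfl, h⟩ := hf
  exact ⟨F₀, rfl, h.mono hmn⟩

lemma congr (hf : HasJet x₀ n f F) (hfg : g =ᶠ[𝓝 x₀] f) : HasJet x₀ n g F := by
  obtain ⟨F₀, rfl, h⟩ := hf
  exact ⟨F₀, rfl, h.congr hfg⟩

lemma eval_eq {m : ℕ} (hf : HasJet x₀ n f F) (hg : HasJet x₀ m g F) : f x₀ = g x₀ := by
  obtain ⟨F₀, rfl, h⟩ := hf
  obtain ⟨G₀, hG, h'⟩ := hg
  rw [h.eval, h'.eval, IsFractionRing.injective _ _ hG]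

lemma ne_zero (hf : HasJet x₀ n f F) (h0 : f x₀ ≠ 0) : F ≠ 0 := by
  rintro rfl
  obtain ⟨F₀, hF, h⟩ := hf
  rw [h.eval, (map_eq_zero_iff _ (IsFractionRing.injective _ _)).1 hF, map_zero] at h0
  exact h0 rfl

/-- This turns differential equations between smooth functions into equations in the differential
field. -/
lemma unique (hF : ∀ n, HasJet x₀ n f F) (hG : ∀ n, HasJet x₀ n f G) : F = G := by
  obtain ⟨F₀, rfl, -⟩ := hF 0
  obtain ⟨G₀, rfl, -⟩ := hG 0
  congr 1
  refine HasPowerJet.unique (x₀ := x₀) (f := f) (fun n => ?_) fun n => ?_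
  · obtain ⟨F₁, h1, h⟩ := hF n
    rwa [← IsFractionRing.injective _ _ h1]
  · obtain ⟨F₁, h1, h⟩ := hG n
    rwa [← IsFractionRing.injective _ _ h1]

lemma deriv (hf : HasJet x₀ (n + 1) f F) :
    HasJet x₀ n (deriv f) (seriesDeriv 𝕜 F) := by
  obtain ⟨F₀, rfl, h⟩ := hf
  refine ⟨_, ?_, h.deriv⟩
  rw [seriesDeriv, fracDeriv_algebraMap]

lemma add (hf : HasJet x₀ n f F) (hg : HasJet x₀ n g G) :
    HasJet x₀ n (fun t => f t + g t) (F + G) := by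
  obtain ⟨F₀, rfl, h⟩ := hf
  obtain ⟨G₀, rfl, h'⟩ := hg
  exact ⟨_, map_add _ _ _, h.add h'⟩

lemma mul (hf : HasJet x₀ n f F) (hg : HasJet x₀ n g G) :
    HasJet x₀ n (fun t => f t * g t) (F * G) := by
  obtain ⟨F₀, rfl, h⟩ := hf
  obtain ⟨G₀, rfl, h'⟩ := hg
  exact ⟨_, map_mul _ _ _, h.mul h'⟩

lemma intCast (n : ℕ) (a : ℤ) : HasJet x₀ n (fun _ => (a : 𝕜)) (a : SeriesField 𝕜) :=
  ⟨C (a : 𝕜), by simp, hasPowerJet_const n _⟩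

lemma neg (hf : HasJet x₀ n f F) : HasJet x₀ n (fun t => - f t) (-F) := by
  simpa using (intCast n (-1)).mul hf

lemma sub (hf : HasJet x₀ n f F) (hg : HasJet x₀ n g G) :
    HasJet x₀ n (fun t => f t - g t) (F - G) := by
  simpa [sub_eq_add_neg] using hf.add hg.neg

lemma inv (hf : HasJet x₀ n f F) (h0 : f x₀ ≠ 0) : HasJet x₀ n (fun t => (f t)⁻¹) F⁻¹ := by
  obtain ⟨F₀, rfl, h⟩ := hf
  refine ⟨F₀⁻¹, ?_, h.inv h0⟩
  have : F₀ * F₀⁻¹ = 1 := PowerSeries.mul_inv_cancel _ (by rwa [← h.eval])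
  refine eq_inv_of_mul_eq_one_right ?_
  rw [← map_mul, this, map_one]

lemma div (hf : HasJet x₀ n f F) (hg : HasJet x₀ n g G) (h0 : g x₀ ≠ 0) :
    HasJet x₀ n (fun t => f t / g t) (F / G) := by
  simpa [div_eq_mul_inv] using hf.mul (hg.inv h0)

lemma pow (hf : HasJet x₀ n f F) (m : ℕ) : HasJet x₀ n (fun t => f t ^ m) (F ^ m) := by
  induction m with
  | zero => simpa using intCast (x₀ := x₀) n 1
  | succ m ih => simpa [pow_succ] using ih.mul hf

lemma sum {ι : Type*} (s : Finset ι) {f : ι → 𝕜 → 𝕜} {F : ι → SeriesField 𝕜}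
    (h : ∀ i, HasJet x₀ n (f i) (F i)) :
    HasJet x₀ n (fun t => ∑ i ∈ s, f i t) (∑ i ∈ s, F i) := by
  classical
  induction s using Finset.induction_on with
  | empty => simpa using intCast (x₀ := x₀) n 0
  | insert a s ha ih => simpa [Finset.sum_insert ha] using (h a).add ih

lemma prod {ι : Type*} (s : Finset ι) {f : ι → 𝕜 → 𝕜} {F : ι → SeriesField 𝕜}
    (h : ∀ i, HasJet x₀ n (f i) (F i)) :
    HasJet x₀ n (fun t => ∏ i ∈ s, f i t) (∏ i ∈ s, F i) := by
  classical
  induction s using Finset.induction_on with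
  | empty => simpa using intCast (x₀ := x₀) n 1
  | insert a s ha ih => simpa [Finset.prod_insert ha] using (h a).mul ih

lemma det {m : ℕ} {f : Fin m → Fin m → 𝕜 → 𝕜} {F : Fin m → Fin m → SeriesField 𝕜}
    (h : ∀ i j, HasJet x₀ n (f i j) (F i j)) :
    HasJet x₀ n (fun t => (Matrix.of fun i j => f i j t).det) (Matrix.of F).det := by
  simp only [Matrix.det_apply', Matrix.of_apply]
  exact sum _ fun σ => (intCast n _).mul (prod _ fun i => h _ _)

lemma iteratedDeriv {m : ℕ} (hf : HasJet x₀ (n + m) f F) :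
    HasJet x₀ n (iteratedDeriv m f) ((seriesDeriv 𝕜)^[m] F) := by
  induction m generalizing f F with
  | zero => simpa using hf
  | succ m ih =>
    rw [iteratedDeriv_succ', Function.iterate_succ_apply]
    exact ih hf.deriv

/-- An m by m Wronskian uses only m - 1 derivatives. -/
lemma wr {N m : ℕ} (hN : n + m ≤ N + 1) {f : Fin m → 𝕜 → 𝕜} {F : Fin m → SeriesField 𝕜}
    (h : ∀ j, HasJet x₀ N (f j) (F j)) : HasJet x₀ n (Wr f) (wr (seriesDeriv 𝕜) F) :=
  det fun i j => ((h j).mono (m := n + i) (by omega)).iteratedDeriv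

lemma snoc {m : ℕ} {f : Fin m → 𝕜 → 𝕜} {F : Fin m → SeriesField 𝕜}
    (h : ∀ j, HasJet x₀ n (f j) (F j)) (hg : HasJet x₀ n g G) (j : Fin (m + 1)) :
    HasJet x₀ n ((Fin.snoc f g : Fin (m + 1) → 𝕜 → 𝕜) j)
      ((Fin.snoc F G : Fin (m + 1) → SeriesField 𝕜) j) := by
  refine Fin.lastCases ?_ (fun j => ?_) j
  · simpa using hg
  · simpa using h j

lemma wrOmit {N m : ℕ} (hN : n + m ≤ N + 2) {f : Fin m → 𝕜 → 𝕜} {F : Fin m → SeriesField 𝕜}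
    (h : ∀ j, HasJet x₀ N (f j) (F j)) (j : Fin m) :
    HasJet x₀ n (WrOmit f j) (wrOmit (seriesDeriv 𝕜) F j) := by
  cases m with
  | zero => exact j.elim0
  | succ m => exact wr (by omega) fun i => h _

lemma compose {m : ℕ} {S : Fin m → (𝕜 → 𝕜) → 𝕜 → 𝕜}
    {S' : Fin m → SeriesField 𝕜 → SeriesField 𝕜}
    (hS : ∀ i n f F, HasJet x₀ (n + 2) f F → HasJet x₀ n (S i f) (S' i F))
    (hf : HasJet x₀ (n + 2 * m) f F) :
    HasJet x₀ n (compose S f) (compose S' F) := by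
  induction m generalizing n with
  | zero => simpa [ExceptionalHermite.compose] using hf
  | succ m ih =>
    have := hS 0 n _ _ (ih (S := fun i => S i.succ) (S' := fun i => S' i.succ)
      (fun i => hS i.succ) (n := n + 2) (by rwa [show n + 2 + 2 * m = n + 2 * (m + 1) by ring]))
    simpa [ExceptionalHermite.compose, List.ofFn_succ] using this

end HasJet

lemma ContDiffAt.exists_hasJet {n : ℕ} {f : 𝕜 → 𝕜} (hf : ContDiffAt 𝕜 n f x₀) :
    ∃ F, HasJet x₀ n f F :=
  ⟨_, _, rfl, ContDiffAt.exists_hasPowerJet hf⟩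

lemma ContDiff.exists_hasJet {f : 𝕜 → 𝕜} (hf : ∀ n : ℕ, ContDiff 𝕜 n f) (x₀ : 𝕜) :
    ∃ F, ∀ n, HasJet x₀ n f F :=
  ⟨_, fun n => ⟨_, rfl, ContDiffAt.exists_hasPowerJet (hf n).contDiffAt⟩⟩

end ExceptionalHermite

/-! ### Hermite polynomials and the jets of A and B. -/

namespace ExceptionalHermite

open Filter Topology DiffOp

/-- The differential equation for H_n gives the derivative of H_{n+1}; differentiating that yields
the equation for H_{n+1}. -/
lemma derivative_physHermite_and_ode (n : ℕ) :
    Polynomial.derivative (physHermite (n + 1)) = 2 * ((n : Polynomial ℤ) + 1) * physHermite n ∧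
      Polynomial.derivative (Polynomial.derivative (physHermite n)) =
        2 * Polynomial.X * Polynomial.derivative (physHermite n) - 2 * (n : Polynomial ℤ) * physHermite n := by
  have key : ∀ n : ℕ, Polynomial.derivative (Polynomial.derivative (physHermite n)) =
        2 * Polynomial.X * Polynomial.derivative (physHermite n) - 2 * (n : Polynomial ℤ) * physHermite n →
      Polynomial.derivative (physHermite (n + 1)) = 2 * ((n : Polynomial ℤ) + 1) * physHermite n := fun n h => by
    rw [physHermite, map_sub, h]
    simp only [Polynomial.derivative_mul, Polynomial.derivative_X, Polynomial.derivative_ofNat,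
      zero_mul, mul_one, zero_add]
    ring
  suffices hode : Polynomial.derivative (Polynomial.derivative (physHermite n)) =
      2 * Polynomial.X * Polynomial.derivative (physHermite n) -
        2 * (n : Polynomial ℤ) * physHermite n from ⟨key n hode, hode⟩
  induction n with
  | zero => simp [physHermite]
  | succ n ih =>
    have h : Polynomial.derivative (Polynomial.derivative (physHermite (n + 1))) =
        2 * Polynomial.X * Polynomial.derivative (physHermite (n + 1)) -
          2 * ((n + 1 : ℕ) : Polynomial ℤ) * physHermite (n + 1) := by
      rw [key n ih, physHermite]
      simp only [Polynomial.derivative_mul, Polynomial.derivative_ofNat, map_add,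
        Polynomial.derivative_natCast, Polynomial.derivative_one]
      push_cast
      ring
    exact h

variable {𝕜 : Type*} [RCLike 𝕜]

lemma h_eq_aeval (n : ℕ) : h 𝕜 n = fun t => Polynomial.aeval t (physHermite n) := rfl

lemma deriv_h (n : ℕ) : deriv (h 𝕜 (n + 1)) = fun t => 2 * (n + 1) * h 𝕜 n t := by
  funext t
  rw [h_eq_aeval, Polynomial.deriv_aeval, (derivative_physHermite_and_ode n).1]
  have h2 : Polynomial.aeval t (2 : Polynomial ℤ) = 2 := map_ofNat _ 2
  simp [h_eq_aeval, h2]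

lemma deriv_deriv_h (n : ℕ) (t : 𝕜) :
    deriv (deriv (h 𝕜 n)) t - 2 * t * deriv (h 𝕜 n) t + 2 * n * h 𝕜 n t = 0 := by
  have h1 : deriv (h 𝕜 n) = fun t => Polynomial.aeval t (Polynomial.derivative (physHermite n)) := by
    funext t
    rw [h_eq_aeval, Polynomial.deriv_aeval]
  rw [h1, Polynomial.deriv_aeval, (derivative_physHermite_and_ode n).2]
  have h2 : Polynomial.aeval t (2 : Polynomial ℤ) = 2 := map_ofNat _ 2
  simp [h_eq_aeval, h2]

lemma contDiff_h (j n : ℕ) : ContDiff 𝕜 n (h 𝕜 j) := Polynomial.contDiff_aeval _ _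

lemma exists_eta_eq_eval {ℓ : ℕ} (lam : Fin ℓ → ℕ) :
    ∃ p : Polynomial ℤ, ∀ t, η 𝕜 lam t = Polynomial.aeval t p := by
  refine ⟨Matrix.det (Matrix.of fun i j : Fin ℓ =>
    Polynomial.derivative^[i] (physHermite (kSeq lam j))), fun t => ?_⟩
  rw [η, Wr, AlgHom.map_det]
  congr 1
  ext i j
  have : ∀ (i : ℕ) (q : Polynomial ℤ), iteratedDeriv i (fun t : 𝕜 => Polynomial.aeval t q) =
      fun t => Polynomial.aeval t (Polynomial.derivative^[i] q) := by
    intro i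
    induction i with
    | zero => intro q; simp
    | succ i ih =>
      intro q
      have hq : deriv (fun t : 𝕜 => Polynomial.aeval t q) =
          fun t => Polynomial.aeval t (Polynomial.derivative q) := by
        funext t
        rw [Polynomial.deriv_aeval]
      rw [iteratedDeriv_succ', hq, ih, Function.iterate_succ_apply]
  simp [hK, h_eq_aeval, this]

/-- Expansions at `x₀` of the Hermite polynomials, of the variable and of the weight. -/
lemma exists_jets (x₀ : 𝕜) : ∃ (Φ : ℕ → SeriesField 𝕜) (x E : SeriesField 𝕜),
    (∀ (n j : ℕ), HasJet x₀ n (h 𝕜 j) (Φ j)) ∧ (∀ n, HasJet x₀ n (fun t => t) x) ∧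
    (∀ n, HasJet x₀ n (fun t => NormedSpace.exp (t ^ 2)) E) ∧
    seriesDeriv 𝕜 x = 1 ∧ (∀ j : ℕ, hermOp (seriesDeriv 𝕜) x (2 * j) (Φ j) = 0) ∧
    (∀ j, Φ j ≠ 0) ∧ E ≠ 0 ∧ seriesDeriv 𝕜 E = 2 * x * E := by
  choose Φ hΦ using fun j => ContDiff.exists_hasJet (contDiff_h (𝕜 := 𝕜) j) x₀
  obtain ⟨x, hx⟩ := ContDiff.exists_hasJet (f := fun t : 𝕜 => t) (fun n => contDiff_id) x₀
  have hexp : ∀ n : ℕ, ContDiff 𝕜 n (fun t : 𝕜 => NormedSpace.exp (t ^ 2)) := fun n => by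
    have h1 : ContDiff 𝕜 n (NormedSpace.exp : 𝕜 → 𝕜) :=
      contDiff_iff_contDiffAt.2 fun t => (NormedSpace.exp_analytic (𝕂 := 𝕜) t).contDiffAt
    exact h1.comp (contDiff_id.pow 2)
  obtain ⟨E, hE⟩ := ContDiff.exists_hasJet hexp x₀
  have htwo : ∀ n, HasJet x₀ n (fun _ => (2 : 𝕜)) 2 := fun n => by
    simpa using HasJet.intCast (x₀ := x₀) n 2
  have hnat : ∀ n (j : ℕ), HasJet x₀ n (fun _ => (j : 𝕜)) j := fun n j => by
    simpa using HasJet.intCast (x₀ := x₀) n j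
  have hΦ0 : Φ 0 = 1 := by
    refine HasJet.unique (hΦ 0) fun n => ?_
    simpa [h_eq_aeval, physHermite] using HasJet.intCast (x₀ := x₀) n 1
  have hstep : ∀ j, seriesDeriv 𝕜 (Φ (j + 1)) = 2 * (j + 1 : ℕ) * Φ j := fun j => by
    refine HasJet.unique (fun n => (hΦ (j + 1) (n + 1)).deriv) fun n => ?_
    rw [deriv_h]
    simpa using ((htwo n).mul (hnat n (j + 1))).mul (hΦ j n)
  refine ⟨Φ, x, E, fun n j => hΦ j n, hx, hE, ?_, fun j => ?_, fun j => ?_, ?_, ?_⟩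
  · refine HasJet.unique (fun n => (hx (n + 1)).deriv) fun n => ?_
    simpa using HasJet.intCast (x₀ := x₀) n 1
  · rw [hermOp_apply]
    refine HasJet.unique (fun n => (((hΦ j (n + 2)).deriv.deriv).sub
      (((htwo n).mul (hx n)).mul (hΦ j (n + 1)).deriv)).add
        (((htwo n).mul (hnat n j)).mul (hΦ j n))) fun n => ?_
    simp only [deriv_deriv_h]
    simpa using HasJet.intCast (x₀ := x₀) n 0
  -- The derivative of Φ (j + 1) is a nonzero multiple of Φ j, and Φ 0 = 1.
  · induction j with
    | zero => simp [hΦ0]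
    | succ j ih =>
      intro h0
      have h1 := hstep j
      rw [h0, map_zero] at h1
      have h2 : (2 * (j + 1 : ℕ) : SeriesField 𝕜) ≠ 0 :=
        mul_ne_zero two_ne_zero (Nat.cast_ne_zero.2 j.succ_ne_zero)
      exact mul_ne_zero h2 ih h1.symm
  · refine (hE 0).ne_zero ?_
    exact (NormedSpace.isUnit_exp _).ne_zero
  · refine HasJet.unique (fun n => (hE (n + 1)).deriv) fun n => ?_
    have h1 : deriv (fun t : 𝕜 => NormedSpace.exp (t ^ 2)) =
        fun t => 2 * t * NormedSpace.exp (t ^ 2) := by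
      funext t
      have h2 : HasDerivAt (NormedSpace.exp : 𝕜 → 𝕜) (NormedSpace.exp (t ^ 2)) (t ^ 2) :=
        hasDerivAt_exp
      have h3 : HasDerivAt (fun t : 𝕜 => NormedSpace.exp (t ^ 2)) _ t :=
        h2.comp t (hasDerivAt_pow 2 t)
      rw [h3.deriv]
      simp [mul_comm]
    rw [h1]
    exact ((htwo n).mul (hx n)).mul (hE n)

lemma piFun_eq_eval {ℓ : ℕ} (lam : Fin ℓ → ℕ) (n : ℕ) :
    piFun lam n = (shiftPoly (kSeq lam)).eval (-2 * (n : ℤ)) := by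
  simp [piFun, shiftPoly, Polynomial.eval_prod]

lemma kSeq_injective {ℓ : ℕ} {lam : Fin ℓ → ℕ} (hmono : Monotone lam) :
    Function.Injective (kSeq lam) := by
  refine StrictMono.injective fun i j hij => ?_
  have := hmono hij.le
  have : (i : ℕ) < j := hij
  simp only [kSeq]
  omega

section Jets

variable {x₀ : 𝕜} {ℓ : ℕ} {lam : Fin ℓ → ℕ} {φ : Fin ℓ → SeriesField 𝕜}

lemma hasJet_eta (hφ : ∀ n j, HasJet x₀ n (hK 𝕜 lam j) (φ j)) (n : ℕ) :
    HasJet x₀ n (η 𝕜 lam) (wr (seriesDeriv 𝕜) φ) :=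
  HasJet.wr (N := n + ℓ) (by omega) fun j => hφ _ j

lemma hasJet_opA (hφ : ∀ n j, HasJet x₀ n (hK 𝕜 lam j) (φ j)) {n : ℕ} {y : 𝕜 → 𝕜}
    {Y : SeriesField 𝕜} (hy : HasJet x₀ (n + ℓ) y Y) :
    HasJet x₀ n (opA lam y) (wrOp (seriesDeriv 𝕜) φ Y) := by
  rw [wrOp_apply]
  exact HasJet.wr (N := n + ℓ) (by omega) (HasJet.snoc (fun j => hφ _ j) hy)

lemma hasJet_opB (hφ : ∀ n j, HasJet x₀ n (hK 𝕜 lam j) (φ j)) (hη : η 𝕜 lam x₀ ≠ 0)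
    {E : SeriesField 𝕜} (hE : ∀ n, HasJet x₀ n (fun t => NormedSpace.exp (t ^ 2)) E) {n : ℕ}
    {y : 𝕜 → 𝕜} {Y : SeriesField 𝕜} (hy : HasJet x₀ (n + ℓ) y Y) :
    HasJet x₀ n (opB lam y) (dualOp (seriesDeriv 𝕜) E φ Y) := by
  have hexp : ∀ n, HasJet x₀ n (fun t => NormedSpace.exp (-t ^ 2)) E⁻¹ := fun n => by
    simpa only [NormedSpace.exp_neg] using (hE n).inv (NormedSpace.isUnit_exp _).ne_zero
  have hsign : HasJet x₀ n (fun _ => (-1 : 𝕜) ^ (ℓ / 2)) ((-1) ^ (ℓ / 2)) := by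
    simpa using HasJet.intCast (x₀ := x₀) n ((-1) ^ (ℓ / 2))
  exact ((hsign.mul (hE n)).mul (((hasJet_eta hφ n).pow ℓ).inv (pow_ne_zero _ hη))).mul
    (HasJet.wr (N := n + ℓ) (by omega)
      (HasJet.snoc (fun j => HasJet.wrOmit (N := n + ℓ + ℓ) (by omega) (fun j => hφ _ j) j)
        ((hexp _).mul hy)))

end Jets

end ExceptionalHermite

/-! ### Jets of T and T̂, zeros of η, and the theorem. -/

namespace ExceptionalHermite

open Filter Topology DiffOp

section Operators

variable {𝕜 : Type*} [RCLike 𝕜] {x₀ : 𝕜} {x : SeriesField 𝕜} {n : ℕ} {f : 𝕜 → 𝕜}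
  {F : SeriesField 𝕜}

lemma hasJet_opT (hx : ∀ n, HasJet x₀ n (fun t => t) x) (k : ℕ) (hf : HasJet x₀ (n + 2) f F) :
    HasJet x₀ n (addScalar opT (2 * (k : 𝕜)) f)
      (hermOp (seriesDeriv 𝕜) x 0 F + 2 * (k : SeriesField 𝕜) * F) := by
  have htwo : HasJet x₀ n (fun _ => (2 : 𝕜)) 2 := by simpa using HasJet.intCast (x₀ := x₀) n 2
  have hk : HasJet x₀ n (fun _ => (k : 𝕜)) k := by simpa using HasJet.intCast (x₀ := x₀) n k
  have h1 : HasJet x₀ (n + 1) f F := hf.mono (by omega)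
  have := ((hf.deriv.deriv).sub ((htwo.mul (hx n)).mul h1.deriv)).add
    ((htwo.mul hk).mul (hf.mono (m := n) (by omega)))
  rw [hermOp_apply, zero_mul, add_zero]
  exact this

lemma hasJet_opThat {ℓ : ℕ} {lam : Fin ℓ → ℕ} {e : SeriesField 𝕜}
    (hx : ∀ n, HasJet x₀ n (fun t => t) x) (he : ∀ n, HasJet x₀ n (η 𝕜 lam) e)
    (hη : η 𝕜 lam x₀ ≠ 0) (k : ℕ) (hf : HasJet x₀ (n + 2) f F) :
    HasJet x₀ n (addScalar (opThat lam) (-2 * (ℓ : 𝕜) + 2 * (k : 𝕜)) f)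
      (hatOp (seriesDeriv 𝕜) x e (-2 * ℓ) F + 2 * (k : SeriesField 𝕜) * F) := by
  have htwo : HasJet x₀ n (fun _ => (2 : 𝕜)) 2 := by simpa using HasJet.intCast (x₀ := x₀) n 2
  have hc : HasJet x₀ n (fun _ => -2 * (ℓ : 𝕜) + 2 * (k : 𝕜)) (-2 * ℓ + 2 * k) := by
    simpa using HasJet.intCast (x₀ := x₀) n (-2 * ℓ + 2 * k)
  have h0 : HasJet x₀ n f F := hf.mono (by omega)
  have h1 : HasJet x₀ (n + 1) f F := hf.mono (by omega)
  have hlog := (he (n + 1)).deriv.div (he n) hη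
  have := ((hf.deriv.deriv.sub ((htwo.mul ((hx n).add hlog)).mul h1.deriv)).add
    ((((he (n + 2)).deriv.deriv.div (he n) hη).add ((htwo.mul (hx n)).mul hlog)).mul h0)).add
      (hc.mul h0)
  have hsplit : ∀ A B c k : SeriesField 𝕜,
      A + (B + c) * F + 2 * k * F = A + B * F + (c + 2 * k) * F := fun A B c k => by ring
  rw [hatOp_apply, hsplit]
  exact this

end Operators

/-- η is a polynomial, and it is nonzero because its expansion at 0 is the Wronskian shown nonzero
by `isDarboux`. -/
lemma finite_eta_eq_zero {𝕜 : Type*} [RCLike 𝕜] {ℓ : ℕ} {lam : Fin ℓ → ℕ}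
    (hmono : Monotone lam) : {t : 𝕜 | η 𝕜 lam t = 0}.Finite := by
  obtain ⟨p, hp⟩ := exists_eta_eq_eval (𝕜 := 𝕜) lam
  obtain ⟨Φ, x, E, hΦ, hx, hE, hDx, hode, hΦ0, hE0, hDE⟩ := exists_jets (0 : 𝕜)
  have hη := hasJet_eta (lam := lam) fun n j => hΦ n (kSeq lam j)
  have hp0 : p.map (Int.castRingHom 𝕜) ≠ 0 := by
    intro h0
    refine (isDarboux hDx (kSeq_injective hmono) (fun i => hode (kSeq lam i))
      fun i => hΦ0 _).wr_ne_zero (HasJet.unique hη fun n => ?_)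
    have h1 : η 𝕜 lam = fun _ => 0 := by
      funext t
      rw [hp, Polynomial.aeval_def, Polynomial.eval₂_eq_eval_map]
      simp [h0]
    rw [h1]
    simpa using HasJet.intCast (x₀ := (0 : 𝕜)) n 0
  refine (Polynomial.finite_setOfPred_isRoot hp0).subset fun t ht => ?_
  rw [Set.mem_ofPred_eq, hp, Polynomial.aeval_def, Polynomial.eval₂_eq_eval_map] at ht
  exact ht

end ExceptionalHermite

theorem corollary4 {𝕜 : Type*} [RCLike 𝕜] (ℓ : ℕ) (lam : Fin ℓ → ℕ)
    (hmono : Monotone lam) (hpos : ∀ i, 0 < lam i) :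
    -- the operators are defined outside a finite set
    {x : 𝕜 | ExceptionalHermite.η 𝕜 lam x = 0}.Finite ∧
    -- `B ∘ A = (T + 2 k_1) ∘ ⋯ ∘ (T + 2 k_ℓ)`
    (∀ (y : 𝕜 → 𝕜) (x : 𝕜), ExceptionalHermite.η 𝕜 lam x ≠ 0 →
      ContDiffAt 𝕜 ((2 * ℓ : ℕ) : WithTop ℕ∞) y x →
      ExceptionalHermite.opB lam (ExceptionalHermite.opA lam y) x =
        ExceptionalHermite.compose
          (fun i : Fin ℓ => ExceptionalHermite.addScalar ExceptionalHermite.opT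
            (2 * (ExceptionalHermite.kSeq lam i : 𝕜))) y x) ∧
    -- `A ∘ B = (T̂ - 2 ℓ + 2 k_1) ∘ ⋯ ∘ (T̂ - 2 ℓ + 2 k_ℓ)`
    (∀ (y : 𝕜 → 𝕜) (x : 𝕜), ExceptionalHermite.η 𝕜 lam x ≠ 0 →
      ContDiffAt 𝕜 ((2 * ℓ : ℕ) : WithTop ℕ∞) y x →
      ExceptionalHermite.opA lam (ExceptionalHermite.opB lam y) x =
        ExceptionalHermite.compose
          (fun i : Fin ℓ => ExceptionalHermite.addScalar (ExceptionalHermite.opThat lam)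
            (-2 * (ℓ : 𝕜) + 2 * (ExceptionalHermite.kSeq lam i : 𝕜))) y x) ∧
    -- `(B ∘ A) h(n, x) = π(n) h(n, x)`
    (∀ (n : ℕ) (x : 𝕜), ExceptionalHermite.η 𝕜 lam x ≠ 0 →
      ExceptionalHermite.opB lam (ExceptionalHermite.opA lam (ExceptionalHermite.h 𝕜 n)) x =
        (ExceptionalHermite.piFun lam n : 𝕜) * ExceptionalHermite.h 𝕜 n x) ∧
    -- `(A ∘ B) ĥ(n, x) = π(n - N + ℓ) ĥ(n, x)`
    (∀ (n : ℕ) (x : 𝕜), ExceptionalHermite.size lam ≤ n + ℓ →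
      ExceptionalHermite.η 𝕜 lam x ≠ 0 →
      ExceptionalHermite.opA lam (ExceptionalHermite.opB lam (ExceptionalHermite.hHat 𝕜 lam n)) x =
        (ExceptionalHermite.piFun lam ((n : ℤ) - (ExceptionalHermite.size lam : ℤ) + (ℓ : ℤ)) : 𝕜) *
          ExceptionalHermite.hHat 𝕜 lam n x) := by
  refine ⟨ExceptionalHermite.finite_eta_eq_zero hmono, fun y x₀ hη hy => ?_, fun y x₀ hη hy => ?_,
    fun n x₀ hη => ?_, fun n x₀ hn hη => ?_⟩
  all_goals
    obtain ⟨Φ, x, E, hΦ, hx, hE, hDx, hode, hΦ0, hE0, hDE⟩ := ExceptionalHermite.exists_jets x₀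
    have hφ : ∀ n j, ExceptionalHermite.HasJet x₀ n (ExceptionalHermite.hK 𝕜 lam j)
      (Φ (ExceptionalHermite.kSeq lam j)) := fun n j => hΦ n _
    have hk := ExceptionalHermite.kSeq_injective hmono
    have hBA := DiffOp.dualOp_wrOp hDx hk (fun i => hode (ExceptionalHermite.kSeq lam i))
      (fun i => hΦ0 _) hE0 hDE
    have hAB := DiffOp.wrOp_dualOp hDx hk (fun i => hode (ExceptionalHermite.kSeq lam i))
      (fun i => hΦ0 _) hE0 hDE
  · obtain ⟨Y, hY⟩ := ExceptionalHermite.ContDiffAt.exists_hasJet hy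
    have h1 := ExceptionalHermite.hasJet_opB (n := 0) hφ hη hE
      (ExceptionalHermite.hasJet_opA hφ (hY.mono (by omega)))
    rw [hBA, DiffOp.aeval_shiftPoly_apply] at h1
    exact h1.eval_eq (ExceptionalHermite.HasJet.compose (n := 0)
      (fun i n f F hf => ExceptionalHermite.hasJet_opT hx _ hf) (hY.mono (by omega)))
  · obtain ⟨Y, hY⟩ := ExceptionalHermite.ContDiffAt.exists_hasJet hy
    have h1 := ExceptionalHermite.hasJet_opA (n := 0) hφ
      (ExceptionalHermite.hasJet_opB hφ hη hE (hY.mono (by omega)))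
    rw [hAB, DiffOp.aeval_shiftPoly_apply] at h1
    exact h1.eval_eq (ExceptionalHermite.HasJet.compose (n := 0)
      (fun i n f F hf => ExceptionalHermite.hasJet_opThat hx
        (ExceptionalHermite.hasJet_eta hφ) hη _ hf) (hY.mono (by omega)))
  · have h1 := ExceptionalHermite.hasJet_opB (n := 0) hφ hη hE
      (ExceptionalHermite.hasJet_opA hφ (hΦ _ n))
    rw [hBA, DiffOp.aeval_hermOp_apply _ (hode n), ← ExceptionalHermite.piFun_eq_eval] at h1
    exact h1.eval_eq ((ExceptionalHermite.HasJet.intCast 0 _).mul (hΦ 0 n))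
  · set p := n + ℓ - ExceptionalHermite.size lam with hp
    have h1 := ExceptionalHermite.hasJet_opA (n := 0) hφ
      (ExceptionalHermite.hasJet_opB hφ hη hE (ExceptionalHermite.hasJet_opA hφ (hΦ _ p)))
    -- By `hn` the truncated subtraction in p is exact. The eigenvalue equation then follows by
    -- applying A to (B ∘ A) h(p) = π(p) h(p).
    have hcast : (n : ℤ) - (ExceptionalHermite.size lam : ℤ) + (ℓ : ℤ) = (p : ℤ) := by omega
    rw [hBA, DiffOp.aeval_hermOp_apply _ (hode p), ← ExceptionalHermite.piFun_eq_eval,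
      ← zsmul_eq_mul, map_zsmul, zsmul_eq_mul] at h1
    rw [hcast]
    exact h1.eval_eq ((ExceptionalHermite.HasJet.intCast 0 _).mul
      (ExceptionalHermite.hasJet_opA hφ (hΦ _ p)))
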